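/- Let $p$ be a prime number. For an amalgamated product $H_1 *_C H_2$ of groups along a common subgroup $C$, a normal form of $g$ is an expression $g = g_1 g_2\cdots g_k$ ($k\ge 1$) in which every $g_i$ lies in $H_1\setminus C$ or in $H_2\setminus C$ and consecutive $g_i$ lie in different factors; every $g\notin C$ has a normal form, and the length $k$ depends only on $g$ and is called the syllable length $\mathrm{Syl}(g)$; elements of $C$ have syllable length $0$. An element is called cyclically reduced if it lies in $C$ or if its syllable length is $1$ or even. Let $\Sigma_\rho$ be the closed oriented surface of genus $\rho \ge 2$, and let $\pi_1(\Sigma_\rho) = F_1 *_C F_2$ be a decomposition of its fundamental group as an amalgamated product in which, for some $n, m\ge 1$, $F_1 = F(x_1,\dots,x_n,y_1,\dots,y_n)$ is a free group of rank $2n$, $F_2 = F(x'_1,\dots,x'_m,y'_1,\dots,y'_m)$ is a free group of rank $2m$, and $C$ is the cyclic group generated by $$\gamma = [x_1,y_1]\cdots[x_n,y_n] = [x'_1,y'_1]\cdots[x'_m,y'_m].$$ Let $g\in\pi_1(\Sigma_\rho)$ be cyclically reduced of syllable length $2l\ge 2$, and let $h\in\pi_1(\Sigma_\rho)$ be an element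 that is not conjugate to $g$. Then there exist finite $p$-groups $P_1, P_2$, a cyclic group $\bar C$ embedded in both of them, and a homomorphism $\varphi : F_1 *_C F_2 \to P_1 *_{\bar C} P_2$ such that $\varphi(g)$ is cyclically reduced of syllable length $2l = \mathrm{Syl}(g)$ in $P_1 *_{\bar C} P_2$ and $\varphi(h)$ is not conjugate to $\varphi(g)$. -/

import Mathlib

/-- The point of the unit circle at position `s` along the boundary of the closed unit disc, when
the boundary is divided into `N` edges of equal length (edge `k` is `k ≤ s ≤ k + 1`). -/
noncomputable def polygonPoint (N : ℕ) (s : ℝ) : Metric.closedBall (0 : ℂ) 1 :=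
  ⟨(Circle.exp (2 * Real.pi * s / N) : ℂ), by
    rw [mem_closedBall_zero_iff, Circle.norm_coe]⟩

/-- The edge identifications of the `4ρ`-gon with boundary word
`a₁ b₁ a₁⁻¹ b₁⁻¹ ⋯ a_ρ b_ρ a_ρ⁻¹ b_ρ⁻¹`. -/
inductive SurfaceRel (ρ : ℕ) : Metric.closedBall (0 : ℂ) 1 → Metric.closedBall (0 : ℂ) 1 → Prop
  | edgeA (j : ℕ) (hj : j < ρ) (t : ℝ) (h0 : 0 ≤ t) (h1 : t ≤ 1) :
      SurfaceRel ρ (polygonPoint (4 * ρ) (4 * j + t)) (polygonPoint (4 * ρ) (4 * j + 3 - t))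
  | edgeB (j : ℕ) (hj : j < ρ) (t : ℝ) (h0 : 0 ≤ t) (h1 : t ≤ 1) :
      SurfaceRel ρ (polygonPoint (4 * ρ) (4 * j + 1 + t)) (polygonPoint (4 * ρ) (4 * j + 4 - t))

/-- The closed oriented surface of genus `ρ ≥ 1`: the closed disc, seen as a `4ρ`-gon, with its
edges identified in pairs, and the quotient topology. -/
def ClosedSurface (ρ : ℕ) : Type := Quot (SurfaceRel ρ)

instance (ρ : ℕ) : TopologicalSpace (ClosedSurface ρ) :=
  inferInstanceAs (TopologicalSpace (Quot (SurfaceRel ρ)))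

/-- The element `[x₁, y₁] ⋯ [x_k, y_k]` of the free group on `x₁, …, x_k, y₁, …, y_k`. -/
def commutatorProduct (k : ℕ) : FreeGroup (Fin k ⊕ Fin k) :=
  (List.ofFn fun i : Fin k =>
    FreeGroup.of (Sum.inl i) * FreeGroup.of (Sum.inr i) *
      (FreeGroup.of (Sum.inl i))⁻¹ * (FreeGroup.of (Sum.inr i))⁻¹).prod

/-- The two maps of the infinite cyclic group to the free groups of ranks `2 n₀` and `2 n₁`
that send the generator to the product of commutators `γ`. They are injective if `n₀, n₁ ≥ 1`. -/
def surfaceAmalgamMap (n : Fin 2 → ℕ) (i : Fin 2) :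
    Multiplicative ℤ →* FreeGroup (Fin (n i) ⊕ Fin (n i)) :=
  zpowersHom _ (commutatorProduct (n i))

/-- The amalgamated product `F₁ *_C F₂`, where `F₁` and `F₂` are free of ranks `2 n₀` and `2 n₁`
and `C` is generated by `γ = [x₁, y₁] ⋯ [x_{n₀}, y_{n₀}] = [x'₁, y'₁] ⋯ [x'_{n₁}, y'_{n₁}]`. -/
abbrev SurfaceAmalgam (n : Fin 2 → ℕ) : Type := Monoid.PushoutI (surfaceAmalgamMap n)

namespace Amalgam

open Monoid

variable {H : Fin 2 → Type*} [∀ i, Group (H i)] {C : Type*} [Group C] {φ : ∀ i, C →* H i}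

/-- `w` is a normal form of `g ∈ H₁ *_C H₂`: a nonempty word with product `g`, whose consecutive
letters come from different factors (this is part of `CoprodI.Word`) and none of whose letters
lies in `C`. -/
def IsNormalForm (g : PushoutI φ) (w : CoprodI.Word H) : Prop :=
  w.toList ≠ [] ∧ PushoutI.Reduced φ w ∧ PushoutI.ofCoprodI w.prod = g

/-- The syllable length of `g`: the length of its normal forms, and `0` for `g ∈ C` (which has no
normal form). By `IsNormalForm.length_eq` all normal forms of `g` have this length. -/
noncomputable def syllableLength (g : PushoutI φ) : ℕ :=
  sInf {k | ∃ w : CoprodI.Word H, IsNormalForm g w ∧ w.toList.length = k}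

/-- `g` is cyclically reduced: it lies in `C`, or has a normal form of length `1` or of even
length. -/
def IsCyclicallyReduced (g : PushoutI φ) : Prop :=
  g ∈ (PushoutI.base φ).range ∨
    ∃ w : CoprodI.Word H, IsNormalForm g w ∧ (w.toList.length = 1 ∨ Even w.toList.length)

theorem IsNormalForm.length_eq (hφ : ∀ i, Function.Injective (φ i)) {g : PushoutI φ}
    {w : CoprodI.Word H} (hw : IsNormalForm g w) : w.toList.length = syllableLength g := by
  have key : ∀ {w' : CoprodI.Word H}, IsNormalForm g w' → w'.toList.length = w.toList.length := by
    intro w' hw'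
    obtain ⟨d⟩ := PushoutI.NormalWord.transversal_nonempty φ hφ
    obtain ⟨v, hv, hvl⟩ := hw.2.1.exists_normalWord_prod_eq d
    obtain ⟨v', hv', hvl'⟩ := hw'.2.1.exists_normalWord_prod_eq d
    have : v = v' := PushoutI.NormalWord.prod_injective (by rw [hv, hv', hw.2.2, hw'.2.2])
    subst this
    simpa using congrArg List.length (hvl'.symm.trans hvl)
  obtain ⟨w', hw', h⟩ := Nat.sInf_mem
    (⟨_, w, hw, rfl⟩ : {k | ∃ w : CoprodI.Word H, IsNormalForm g w ∧ w.toList.length = k}.Nonempty)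
  exact (key hw').symm.trans h

end Amalgam

/-! Conjugacy of cyclically reduced words in an amalgam is rigid: up to rotating the letters, only
conjugation by an element of `C` remains (`exists_linked_of_isConj`). Letter by letter this is a
chain of equations `γ ^ a * x = y * γ ^ b` in the factors, where each `b` is the next `a` and the
last `b` is the first `a`. It therefore suffices to find `p`-power quotients of the factors in which
`γ` has the same order, the letters stay outside `⟨γ⟩`, and every solution of such an equation is
congruent, modulo a large power of `p`, to a true solution in the free group. The true exponents are
bounded; once the modulus exceeds twice the bound, congruent exponents are equal and a conjugacy in
the quotient lifts (`exists_linked_of_linked_mapList`). If `h` is conjugate into a factor, so is its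
image, while the image of `g` is not (`not_isConj_of`).

The separation in a factor is `IsBoundaryElement.exists_zpow_eq`. View `F` as the group of a surface
with one boundary curve `γ`, and let `γ` have order `R` modulo a normal subgroup `N` of `p`-power
index. If `N` is small, `γ ^ R` and `h * γ ^ R * h⁻¹` are different boundary curves of the cover,
and some integer cocycle takes the value 1 on the first and 0 on the second
(`exists_isPNormal_cocycle`). Reducing it modulo `p ^ k` defines a deeper subgroup of `p`-power
index (`kerMod`) that detects exponents modulo `p ^ k`. On a free group cocycles can be prescribed
freely; the one needed is supported on a single edge of the Cayley graph
(`exists_isCocycle_commutator`). -/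

namespace Amalgam

open Monoid

/-! ### Reduced words in an amalgam and their uniqueness -/

section Words

variable {ι : Type*} {G : ι → Type*} [∀ i, Group (G i)] {C : Type*} [Group C]

/-- The product in the amalgam of a list of elements of the factors. -/
def listProd (φ : ∀ i, C →* G i) (L : List (Σ i, G i)) : PushoutI φ :=
  (L.map fun x => PushoutI.of x.1 x.2).prod

/-- A list of elements of the factors is reduced: consecutive letters come from different factors
and no letter lies in the amalgamated subgroup. -/
def IsReduced (φ : ∀ i, C →* G i) (L : List (Σ i, G i)) : Prop :=
  (L.map Sigma.fst).IsChain (· ≠ ·) ∧ ∀ x ∈ L, x.2 ∉ (φ x.1).range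

/-- A nonempty reduced list whose last and first letters come from different factors. -/
def IsCyclicList (φ : ∀ i, C →* G i) (L : List (Σ i, G i)) : Prop :=
  L ≠ [] ∧ Cycle.Chain (· ≠ ·) (L.map Sigma.fst : Cycle ι) ∧ ∀ x ∈ L, x.2 ∉ (φ x.1).range

/-- `Linked φ c L L' c'` says that `L` and `L'` are letterwise in the same double cosets of the
amalgamated subgroup, by means of a sequence of elements of that subgroup that begins with `c`
and ends with `c'`. -/
inductive Linked (φ : ∀ i, C →* G i) : C → List (Σ i, G i) → List (Σ i, G i) → C → Prop
  | nil (c : C) : Linked φ c [] [] c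
  | cons {c c₁ c₂ : C} {i : ι} {x y : G i} {L M : List (Σ i, G i)} :
      φ i c * x = y * φ i c₁ → Linked φ c₁ L M c₂ → Linked φ c (⟨i, x⟩ :: L) (⟨i, y⟩ :: M) c₂

/-- The formal inverse of a list of elements of the factors. -/
def listInv (L : List (Σ i, G i)) : List (Σ i, G i) :=
  (L.map fun x => ⟨x.1, x.2⁻¹⟩).reverse

variable {φ : ∀ i, C →* G i}

@[simp] theorem listProd_nil : listProd φ [] = 1 := rfl

@[simp] theorem listProd_cons (x : Σ i, G i) (L : List (Σ i, G i)) :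
    listProd φ (x :: L) = PushoutI.of x.1 x.2 * listProd φ L := by
  simp [listProd]

@[simp] theorem listProd_append (L M : List (Σ i, G i)) :
    listProd φ (L ++ M) = listProd φ L * listProd φ M := by
  simp [listProd]

@[simp] theorem listProd_listInv (L : List (Σ i, G i)) :
    listProd φ (listInv L) = (listProd φ L)⁻¹ := by
  induction L with
  | nil => simp [listInv]
  | cons x L ih =>
    have h : listInv (x :: L) = listInv L ++ [⟨x.1, x.2⁻¹⟩] := by simp [listInv]
    simp [h, ih]

@[simp] theorem map_fst_listInv (L : List (Σ i, G i)) :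
    (listInv L).map Sigma.fst = (L.map Sigma.fst).reverse := by
  simp [listInv, Function.comp_def]

theorem notMem_range_of_mem_listInv {L : List (Σ i, G i)} (h : ∀ x ∈ L, x.2 ∉ (φ x.1).range) :
    ∀ x ∈ listInv L, x.2 ∉ (φ x.1).range := by
  intro x hx
  simp only [listInv, List.mem_reverse, List.mem_map] at hx
  obtain ⟨y, hy, rfl⟩ := hx
  simpa using h y hy

theorem mul_notMem_range_left {i : ι} (c : C) {x : G i} (hx : x ∉ (φ i).range) :
    φ i c * x ∉ (φ i).range :=
  mt (Subgroup.mul_mem_cancel_left _ (MonoidHom.mem_range.2 ⟨c, rfl⟩)).1 hx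

theorem mul_notMem_range_right {i : ι} (c : C) {x : G i} (hx : x ∉ (φ i).range) :
    x * φ i c ∉ (φ i).range :=
  mt (Subgroup.mul_mem_cancel_right _ (MonoidHom.mem_range.2 ⟨c, rfl⟩)).1 hx

theorem isReduced_nil : IsReduced φ ([] : List (Σ i, G i)) := by simp [IsReduced]

theorem IsReduced.of_cons {x : Σ i, G i} {L : List (Σ i, G i)} (h : IsReduced φ (x :: L)) :
    IsReduced φ L :=
  ⟨by simpa using h.1.tail, fun y hy => h.2 y (List.mem_cons_of_mem _ hy)⟩

theorem IsReduced.cons_of_fst {i : ι} {x y : G i} {L : List (Σ i, G i)}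
    (h : IsReduced φ (⟨i, x⟩ :: L)) (hy : y ∉ (φ i).range) : IsReduced φ (⟨i, y⟩ :: L) := by
  refine ⟨by simpa using h.1, ?_⟩
  rintro z (_ | ⟨_, hz⟩)
  · exact hy
  · exact h.2 z (List.mem_cons_of_mem _ hz)

theorem ofCoprodI_prod_eq_listProd (w : CoprodI.Word G) :
    (PushoutI.ofCoprodI w.prod : PushoutI φ) = listProd φ w.toList := by
  simp [CoprodI.Word.prod, listProd, map_list_prod, Function.comp_def]

/-- The word given by a reduced list. -/
def IsReduced.word {L : List (Σ i, G i)} (h : IsReduced φ L) : CoprodI.Word G where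
  toList := L
  ne_one := fun x hx h1 => h.2 x hx (h1 ▸ one_mem _)
  chain_ne := (List.isChain_map _).1 h.1

theorem IsReduced.eq_nil (hφ : ∀ i, Function.Injective (φ i)) {L : List (Σ i, G i)}
    (h : IsReduced φ L) (hL : listProd φ L ∈ (PushoutI.base φ).range) : L = [] := by
  have := PushoutI.Reduced.eq_empty_of_mem_range hφ (w := h.word) h.2
    (by rw [ofCoprodI_prod_eq_listProd]; exact hL)
  simpa [IsReduced.word, CoprodI.Word.empty] using congrArg CoprodI.Word.toList this

theorem exists_isReduced (hφ : ∀ i, Function.Injective (φ i)) (g : PushoutI φ) :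
    ∃ c L, IsReduced φ L ∧ g = PushoutI.base φ c * listProd φ L := by
  classical
  obtain ⟨d⟩ := PushoutI.NormalWord.transversal_nonempty φ hφ
  obtain ⟨w, rfl⟩ : ∃ w : PushoutI.NormalWord d, w.prod = g :=
    ⟨PushoutI.NormalWord.equiv g, PushoutI.NormalWord.equiv.symm_apply_apply g⟩
  refine ⟨w.head, w.toList, ⟨(List.isChain_map _).2 w.chain_ne, ?_⟩, ?_⟩
  · rintro ⟨i, x⟩ hx hr
    -- A transversal letter lying in `C` factors both as `x * 1` and as `1 * x`, so it is trivial.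
    have := (d.compl i).1 (a₁ := (⟨x, hr⟩, ⟨1, d.one_mem i⟩))
      (a₂ := (⟨1, one_mem _⟩, ⟨x, w.normalized i x hx⟩)) (by simp)
    exact w.ne_one _ hx (by simpa using (congrArg (fun q => (q.2 : G i)) this).symm)
  · rw [PushoutI.NormalWord.prod, ofCoprodI_prod_eq_listProd]

theorem base_mul_listProd_cons (c : C) (i : ι) (x : G i) (L : List (Σ i, G i)) :
    PushoutI.base φ c * listProd φ (⟨i, x⟩ :: L) = listProd φ (⟨i, φ i c * x⟩ :: L) := by
  simp [PushoutI.of_apply_eq_base, mul_assoc]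

theorem Linked.map_fst_eq {c c' : C} {L L' : List (Σ i, G i)} (h : Linked φ c L L' c') :
    L.map Sigma.fst = L'.map Sigma.fst := by
  induction h with
  | nil => rfl
  | cons _ _ ih => simp [ih]

theorem Linked.base_mul_eq {c c' : C} {L L' : List (Σ i, G i)} (h : Linked φ c L L' c') :
    PushoutI.base φ c * listProd φ L = listProd φ L' * PushoutI.base φ c' := by
  induction h with
  | nil => simp
  | @cons c c₁ c' i x y L L' hxy h ih =>
    simp only [listProd_cons]
    rw [mul_assoc, ← ih, ← PushoutI.of_apply_eq_base φ i, ← PushoutI.of_apply_eq_base φ i,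
      ← mul_assoc, ← mul_assoc, ← map_mul, ← map_mul, hxy]

/-- The word `L'⁻¹ * c * L` represents an element of `C`. Unless the first letters of `L'` and `L`
merge into an element of `C`, it is reduced and nonempty, which is impossible. The merged element is
the next link, and induction continues with the tails. -/
theorem linked_of_base_mul_eq (hφ : ∀ i, Function.Injective (φ i)) {c c' : C}
    {L L' : List (Σ i, G i)} (hL : IsReduced φ L) (hL' : IsReduced φ L')
    (h : PushoutI.base φ c * listProd φ L = listProd φ L' * PushoutI.base φ c') :
    Linked φ c L L' c' := by
  induction L generalizing c L' with
  | nil =>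
    obtain rfl := hL'.eq_nil hφ ⟨c * c'⁻¹, by simp_all⟩
    obtain rfl : c = c' := PushoutI.base_injective hφ (by simpa using h)
    exact .nil c
  | cons x L ih =>
    obtain ⟨i, x⟩ := x
    rcases L' with _ | ⟨⟨j, y⟩, L'⟩
    · exact absurd (hL.eq_nil hφ ⟨c⁻¹ * c', by
        rw [map_mul, map_inv, inv_mul_eq_iff_eq_mul, h]; simp⟩) (by simp)
    · have h2 : (PushoutI.of j y)⁻¹ * (PushoutI.base φ c * PushoutI.of i x) * listProd φ L
          = listProd φ L' * PushoutI.base φ c' := by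
        rw [mul_assoc, inv_mul_eq_iff_eq_mul, ← mul_assoc]
        simpa [mul_assoc] using h
      have h1 := hL.1
      have h1' := hL'.1
      have hmem := hL.of_cons.2
      have hmem' := notMem_range_of_mem_listInv hL'.of_cons.2
      have hx : x ∉ (φ i).range := hL.2 _ List.mem_cons_self
      have hy : y ∉ (φ j).range := hL'.2 _ List.mem_cons_self
      simp only [List.map_cons] at h1 h1'
      by_cases hij : i = j
      · subst hij
        by_cases hz : y⁻¹ * (φ i c * x) ∈ (φ i).range
        · obtain ⟨c₁, hc₁⟩ := hz
          refine .cons (c₁ := c₁) (by rw [hc₁]; group) (ih hL.of_cons hL'.of_cons ?_)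
          rw [← h2, ← PushoutI.of_apply_eq_base φ i, hc₁]
          simp [PushoutI.of_apply_eq_base]
        · have hr : IsReduced φ (listInv L' ++ ⟨i, y⁻¹ * (φ i c * x)⟩ :: L) := by
            refine ⟨?_, ?_⟩
            · simp only [List.map_append, map_fst_listInv, List.map_cons]
              rw [List.isChain_cons] at h1'
              rw [List.isChain_append, List.isChain_reverse]
              refine ⟨by simpa [ne_comm] using h1'.2, h1, ?_⟩
              intro k hk l hl
              simp only [List.head?_cons, Option.mem_some_iff, List.getLast?_reverse] at hl hk
              exact hl ▸ (h1'.1 _ hk).symm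
            · simp only [List.mem_append, List.mem_cons]
              rintro z (hz' | rfl | hz')
              exacts [hmem' z hz', hz, hmem z hz']
          refine absurd (hr.eq_nil hφ ⟨c', ?_⟩) (by simp)
          rw [listProd_append, listProd_listInv, eq_inv_mul_iff_mul_eq, ← h2]
          simp [PushoutI.of_apply_eq_base]
      · have hr : IsReduced φ (listInv L' ++ ⟨j, y⁻¹⟩ :: ⟨i, φ i c * x⟩ :: L) := by
          refine ⟨?_, ?_⟩
          · simp only [List.map_append, map_fst_listInv, List.map_cons]
            rw [List.isChain_cons] at h1'
            rw [List.isChain_append, List.isChain_reverse]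
            refine ⟨by simpa [ne_comm] using h1'.2,
              List.isChain_cons.2 ⟨by simpa using Ne.symm hij, h1⟩, ?_⟩
            intro k hk l hl
            simp only [List.head?_cons, Option.mem_some_iff, List.getLast?_reverse] at hl hk
            exact hl ▸ (h1'.1 _ hk).symm
          · simp only [List.mem_append, List.mem_cons]
            rintro z (hz' | rfl | rfl | hz')
            exacts [hmem' z hz', by simpa using hy, mul_notMem_range_left c hx, hmem z hz']
        refine absurd (hr.eq_nil hφ ⟨c', ?_⟩) (by simp)
        rw [listProd_append, listProd_listInv, eq_inv_mul_iff_mul_eq, ← h2]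
        simp [PushoutI.of_apply_eq_base, mul_assoc]

theorem map_fst_eq_of_listProd_eq (hφ : ∀ i, Function.Injective (φ i))
    {L L' : List (Σ i, G i)} (hL : IsReduced φ L) (hL' : IsReduced φ L')
    (h : listProd φ L = listProd φ L') : L.map Sigma.fst = L'.map Sigma.fst :=
  (linked_of_base_mul_eq hφ (c := 1) (c' := 1) hL hL' (by simpa using h)).map_fst_eq

end Words

end Amalgam

namespace Amalgam

open Monoid

/-! ### Conjugacy in an amalgam -/

section Conjugacy

variable {ι : Type*} {G : ι → Type*} [∀ i, Group (G i)] {C : Type*} [Group C] {φ : ∀ i, C →* G i}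

theorem isCyclicList_cons {i : ι} {x : G i} {L : List (Σ i, G i)} :
    IsCyclicList φ (⟨i, x⟩ :: L) ↔
      (i :: (L.map Sigma.fst ++ [i])).IsChain (· ≠ ·) ∧
        x ∉ (φ i).range ∧ ∀ y ∈ L, y.2 ∉ (φ y.1).range := by
  simp [IsCyclicList, -Cycle.chain_coe_cons, Cycle.chain_coe_cons (· ≠ ·) i]

theorem IsCyclicList.isReduced {L : List (Σ i, G i)} (h : IsCyclicList φ L) : IsReduced φ L := by
  rcases L with _ | ⟨⟨i, x⟩, L⟩
  · exact absurd rfl h.1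
  · refine ⟨?_, h.2.2⟩
    have := (isCyclicList_cons.1 h).1
    rw [← List.cons_append] at this
    exact (List.isChain_append.1 this).1

theorem IsCyclicList.of_isRotated {L M : List (Σ i, G i)} (h : IsCyclicList φ L) (hM : M ~r L) :
    IsCyclicList φ M := by
  refine ⟨?_, ?_, fun x hx => h.2.2 x (hM.mem_iff.1 hx)⟩
  · rintro rfl
    exact h.1 (List.isRotated_nil_iff.1 hM.symm)
  · rw [Cycle.coe_eq_coe.2 (hM.map Sigma.fst)]
    exact h.2.1

theorem isConj_of_isRotated {L M : List (Σ i, G i)} (h : M ~r L) :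
    IsConj (listProd φ M) (listProd φ L) := by
  obtain ⟨n, rfl⟩ := h.symm
  rw [List.rotate_eq_drop_append_take_mod, listProd_append]
  have hL : listProd φ L =
      listProd φ (L.take (n % L.length)) * listProd φ (L.drop (n % L.length)) := by
    rw [← listProd_append, List.take_append_drop]
  rw [hL]
  exact isConj_iff.2 ⟨listProd φ (L.take (n % L.length)), by group⟩

theorem IsCyclicList.head?_ne_getLast? {L : List (Σ i, G i)} (h : IsCyclicList φ L) :
    (L.map Sigma.fst).head? ≠ (L.map Sigma.fst).getLast? := by
  rcases L with _ | ⟨⟨i, x⟩, L⟩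
  · exact absurd rfl h.1
  · have := (isCyclicList_cons.1 h).1
    rw [← List.cons_append, List.isChain_append] at this
    intro he
    exact this.2.2 i (by simpa using he.symm) i (by simp) rfl

/-- If `x * y` falls into `C`, the first letter has moved to the end, which is a rotation. Otherwise
`x * y` and `x⁻¹` are the end letters of a strictly longer reduced word. -/
theorem conj_cons_cases {i : ι} {x y : G i} {M : List (Σ i, G i)}
    (hM : IsCyclicList φ (⟨i, y⟩ :: M)) (hx : x ∉ (φ i).range) :
    (∃ M' c, M' ~r ⟨i, y⟩ :: M ∧
      PushoutI.of i x * listProd φ (⟨i, y⟩ :: M) * (PushoutI.of i x)⁻¹ =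
        PushoutI.base φ c * listProd φ M' * (PushoutI.base φ c)⁻¹) ∨
    ∃ L, IsReduced φ L ∧ M.length + 1 < L.length ∧ (L.map Sigma.fst).head? = some i ∧
      (L.map Sigma.fst).getLast? = some i ∧
      PushoutI.of i x * listProd φ (⟨i, y⟩ :: M) * (PushoutI.of i x)⁻¹ = listProd φ L := by
  by_cases hxy : x * y ∈ (φ i).range
  · obtain ⟨c, hc⟩ := hxy
    refine Or.inl ⟨M ++ [⟨i, y⟩], c, List.isRotated_concat _ _, ?_⟩
    obtain rfl : x = φ i c * y⁻¹ := by rw [hc]; group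
    simp [PushoutI.of_apply_eq_base]
    group
  · obtain ⟨h1, -, h3⟩ := isCyclicList_cons.1 hM
    refine Or.inr ⟨⟨i, x * y⟩ :: (M ++ [⟨i, x⁻¹⟩]), ⟨by simpa using h1, ?_⟩, by simp, by simp, ?_, ?_⟩
    · simp only [List.mem_append, List.mem_cons, List.not_mem_nil, or_false]
      rintro z (rfl | hz | rfl)
      exacts [hxy, h3 z hz, by simpa using hx]
    · simp only [List.map_cons, List.map_append, List.map_nil, ← List.cons_append,
        List.getLast?_concat]
    · simp [mul_assoc]

theorem conj_cases {i : ι} {x : G i} {M : List (Σ i, G i)}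
    (hM : IsCyclicList φ M) (hx : x ∉ (φ i).range) :
    (∃ M' c, M' ~r M ∧
      PushoutI.of i x * listProd φ M * (PushoutI.of i x)⁻¹ =
        PushoutI.base φ c * listProd φ M' * (PushoutI.base φ c)⁻¹) ∨
    ∃ L, IsReduced φ L ∧ M.length < L.length ∧ (L.map Sigma.fst).head? = some i ∧
      (L.map Sigma.fst).getLast? = some i ∧
      PushoutI.of i x * listProd φ M * (PushoutI.of i x)⁻¹ = listProd φ L := by
  by_cases hhead : (M.map Sigma.fst).head? = some i
  · rcases M with _ | ⟨⟨j, y⟩, M⟩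
    · exact absurd rfl hM.1
    obtain rfl : j = i := by simpa using hhead
    exact conj_cons_cases hM hx
  by_cases hlast : (M.map Sigma.fst).getLast? = some i
  · rcases List.eq_nil_or_concat M with rfl | ⟨M, ⟨j, z⟩, rfl⟩
    · exact absurd rfl hM.1
    obtain rfl : j = i := by simpa using hlast
    -- Rotating the last letter to the front reduces to `conj_cons_cases`, with conjugator `x *
    -- z⁻¹`.
    have hrot : ⟨j, z⟩ :: M ~r M ++ [⟨j, z⟩] := (List.isRotated_concat _ _).symm
    have he : PushoutI.of j x * listProd φ (M ++ [⟨j, z⟩]) * (PushoutI.of j x)⁻¹ =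
        PushoutI.of j (x * z⁻¹) * listProd φ (⟨j, z⟩ :: M) * (PushoutI.of j (x * z⁻¹))⁻¹ := by
      simp
      group
    rw [List.concat_eq_append] at hM ⊢
    rw [he]
    by_cases hxz : x * z⁻¹ ∈ (φ j).range
    · obtain ⟨c, hc⟩ := hxz
      exact Or.inl ⟨_, c, hrot, by rw [← hc, PushoutI.of_apply_eq_base]⟩
    · rcases conj_cons_cases (hM.of_isRotated hrot) hxz with
        ⟨M', c, h, h'⟩ | ⟨L, h, h', h''⟩
      · exact Or.inl ⟨M', c, h.trans hrot, h'⟩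
      · exact Or.inr ⟨L, h, by simpa using h', h''⟩
  · have hr := hM.isReduced
    refine Or.inr ⟨⟨i, x⟩ :: (M ++ [⟨i, x⁻¹⟩]), ⟨?_, ?_⟩, by simp, by simp, ?_, ?_⟩
    · simp only [List.map_cons, List.map_append, List.map_nil]
      rw [List.isChain_cons, List.isChain_append]
      refine ⟨?_, hr.1, by simp, ?_⟩
      · rintro k hk rfl
        rw [List.head?_append_of_ne_nil _ (by simpa using hM.1)] at hk
        exact hhead hk
      · rintro k hk l hl rfl
        obtain rfl : i = k := by simpa using hl
        exact hlast hk
    · simp only [List.mem_append, List.mem_cons, List.not_mem_nil, or_false]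
      rintro z (rfl | hz | rfl)
      exacts [hx, hr.2 z hz, by simpa using hx]
    · simp only [List.map_cons, List.map_append, List.map_nil, ← List.cons_append,
        List.getLast?_concat]
    · simp [mul_assoc]

/-- The letters of the conjugator act one at a time. Once the word has grown, it begins and ends in
the factor of the last letter applied; the next letter is from another factor, so nothing cancels
any more. -/
theorem conj_listProd_cases {L : List (Σ i, G i)} (hL : IsCyclicList φ L) (c : C)
    {T : List (Σ i, G i)} (hT : IsReduced φ T) :
    (∃ M c', M ~r L ∧
      listProd φ T * PushoutI.base φ c * listProd φ L * (listProd φ T * PushoutI.base φ c)⁻¹ =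
        PushoutI.base φ c' * listProd φ M * (PushoutI.base φ c')⁻¹) ∨
    ∃ L', IsReduced φ L' ∧ L.length < L'.length ∧
      (L'.map Sigma.fst).head? = (T.map Sigma.fst).head? ∧
      (L'.map Sigma.fst).getLast? = (T.map Sigma.fst).head? ∧
      listProd φ T * PushoutI.base φ c * listProd φ L * (listProd φ T * PushoutI.base φ c)⁻¹ =
        listProd φ L' := by
  induction T with
  | nil => exact Or.inl ⟨L, c, List.IsRotated.refl _, by simp⟩
  | cons x T ih =>
    obtain ⟨i, x⟩ := x
    have hx : x ∉ (φ i).range := hT.2 _ List.mem_cons_self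
    have he : listProd φ (⟨i, x⟩ :: T) * PushoutI.base φ c * listProd φ L *
        (listProd φ (⟨i, x⟩ :: T) * PushoutI.base φ c)⁻¹ = PushoutI.of i x *
        (listProd φ T * PushoutI.base φ c * listProd φ L * (listProd φ T * PushoutI.base φ c)⁻¹) *
        (PushoutI.of i x)⁻¹ := by
      simp [mul_assoc]
    rw [he]
    rcases ih hT.of_cons with ⟨M, c', hM, h⟩ | ⟨L', hL', hlen, hh, hlast, h⟩
    · have he' : PushoutI.of i x * (PushoutI.base φ c' * listProd φ M * (PushoutI.base φ c')⁻¹) *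
          (PushoutI.of i x)⁻¹ =
          PushoutI.of i (x * φ i c') * listProd φ M * (PushoutI.of i (x * φ i c'))⁻¹ := by
        simp [PushoutI.of_apply_eq_base, mul_assoc]
      rw [h, he']
      rcases conj_cases (hL.of_isRotated hM) (mul_notMem_range_right c' hx) with
        ⟨M', c'', h, h'⟩ | ⟨L', h, h', h2, h3, h4⟩
      · exact Or.inl ⟨M', c'', h.trans hM, h'⟩
      · exact Or.inr ⟨L', h, by rwa [← hM.perm.length_eq], by simpa using h2, by simpa using h3, h4⟩
    · have hne : (T.map Sigma.fst).head? ≠ some i := by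
        have := hT.1
        rw [List.map_cons, List.isChain_cons] at this
        exact fun hk => this.1 i hk rfl
      have hnil : L'.map Sigma.fst ≠ [] := by
        intro h0
        rw [List.map_eq_nil_iff] at h0
        simp [h0] at hlen
      refine Or.inr ⟨⟨i, x⟩ :: (L' ++ [⟨i, x⁻¹⟩]), ⟨?_, ?_⟩, by simp; omega, by simp, ?_, ?_⟩
      · simp only [List.map_cons, List.map_append, List.map_nil]
        rw [List.isChain_cons, List.isChain_append]
        refine ⟨?_, hL'.1, by simp, ?_⟩
        · rintro k hk rfl
          rw [List.head?_append_of_ne_nil _ hnil] at hk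
          exact hne (hh ▸ hk)
        · rintro k hk l hl rfl
          obtain rfl : i = k := by simpa using hl
          exact hne (hlast ▸ hk)
      · simp only [List.mem_append, List.mem_cons, List.not_mem_nil, or_false]
        rintro z (rfl | hz | rfl)
        exacts [hx, hL'.2 z hz, by simpa using hx]
      · simp only [List.map_cons, List.map_append, List.map_nil, ← List.cons_append,
          List.getLast?_concat, List.head?_cons]
      · rw [h]
        simp [mul_assoc]

theorem conj_cases_of_isCyclicList (hφ : ∀ i, Function.Injective (φ i)) {L : List (Σ i, G i)}
    (hL : IsCyclicList φ L) {g : PushoutI φ} (h : IsConj g (listProd φ L)) :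
    (∃ M c, M ~r L ∧ g = PushoutI.base φ c * listProd φ M * (PushoutI.base φ c)⁻¹) ∨
    ∃ L', IsReduced φ L' ∧ L.length < L'.length ∧
      (L'.map Sigma.fst).head? = (L'.map Sigma.fst).getLast? ∧ g = listProd φ L' := by
  obtain ⟨t, ht⟩ := isConj_iff.1 h.symm
  obtain ⟨c, T, hT, hcT⟩ := exists_isReduced hφ t⁻¹
  have hT' : IsReduced φ (listInv T) :=
    ⟨by simpa [List.isChain_reverse, ne_comm] using hT.1, notMem_range_of_mem_listInv hT.2⟩
  obtain rfl : t = listProd φ (listInv T) * PushoutI.base φ c⁻¹ := by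
    rw [← inv_inj, hcT]; simp
  rcases conj_listProd_cases hL c⁻¹ hT' with ⟨M, c', h, h'⟩ | ⟨L', h, h', h2, h3, h4⟩
  · exact Or.inl ⟨M, c', h, ht ▸ h'⟩
  · exact Or.inr ⟨L', h, h', h2.trans h3.symm, ht ▸ h4⟩

/-- A cyclic list is not conjugate into a factor. -/
theorem not_isConj_of (hφ : ∀ i, Function.Injective (φ i)) {L : List (Σ i, G i)}
    (hL : IsCyclicList φ L) (i : ι) (x : G i) :
    ¬ IsConj (PushoutI.of i x) (listProd φ L) := by
  intro h
  have hlen : ∀ {L' : List (Σ i, G i)} {c : C}, IsReduced φ L' → 1 < L'.length →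
      PushoutI.of i x * PushoutI.base φ c ≠ PushoutI.base φ c * listProd φ L' := by
    intro L' c hL' hlt he
    by_cases hx : x ∈ (φ i).range
    · obtain ⟨c', rfl⟩ := hx
      rw [PushoutI.of_apply_eq_base] at he
      have := (linked_of_base_mul_eq hφ (L' := []) (c' := c' * c) hL' isReduced_nil
        (by rw [← he]; simp)).map_fst_eq
      simp only [List.map_nil, List.map_eq_nil_iff] at this
      simp [this] at hlt
    · have hr : IsReduced φ [⟨i, x⟩] := ⟨by simp, by simpa using hx⟩
      have := (linked_of_base_mul_eq hφ hL' hr (by simpa using he.symm)).map_fst_eq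
      have := congrArg List.length this
      simp at this
      omega
  have hL1 : 1 < L.length := by
    rcases L with _ | ⟨⟨j, y⟩, _ | ⟨z, L⟩⟩
    · exact absurd rfl hL.1
    · have := (isCyclicList_cons.1 hL).1
      simp at this
    · simp
  rcases conj_cases_of_isCyclicList hφ hL h with ⟨M, c, hM, h⟩ | ⟨L', hL', hlt, -, h⟩
  · refine hlen (hL.of_isRotated hM).isReduced (by rwa [hM.perm.length_eq]) (c := c) ?_
    rw [h]; group
  · exact hlen hL' (hL1.trans hlt) (c := 1) (by simp [h])

/-- Conjugacy of cyclic lists: they agree up to rotation and conjugation by the amalgamated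
subgroup. -/
theorem exists_linked_of_isConj (hφ : ∀ i, Function.Injective (φ i)) {L W : List (Σ i, G i)}
    (hL : IsCyclicList φ L) (hW : IsCyclicList φ W) (h : IsConj (listProd φ W) (listProd φ L)) :
    ∃ M c, M ~r L ∧ Linked φ c W M c := by
  rcases conj_cases_of_isCyclicList hφ hL h with ⟨M, c, hM, h⟩ | ⟨L', hL', -, heq, h⟩
  · refine ⟨M, c⁻¹, hM, linked_of_base_mul_eq hφ hW.isReduced (hL.of_isRotated hM).isReduced ?_⟩
    rw [h, map_inv]; group
  · rw [← map_fst_eq_of_listProd_eq hφ hW.isReduced hL' h] at heq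
    exact absurd heq (IsCyclicList.head?_ne_getLast? hW)

/-- Every element of an amalgam is conjugate into a factor or to the product of a cyclic list. -/
theorem exists_isConj [Nonempty ι] (hφ : ∀ i, Function.Injective (φ i)) (g : PushoutI φ) :
    (∃ i x, IsConj (PushoutI.of i x) g) ∨ ∃ L, IsCyclicList φ L ∧ IsConj (listProd φ L) g := by
  obtain ⟨c, L, hL, rfl⟩ := exists_isReduced hφ g
  induction hn : L.length using Nat.strong_induction_on generalizing c L with
  | _ n ih =>
    rcases L with _ | ⟨⟨i, x⟩, L⟩
    · obtain ⟨i⟩ := ‹Nonempty ι›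
      exact Or.inl ⟨i, φ i c, by rw [PushoutI.of_apply_eq_base, listProd_nil, mul_one]⟩
    have hx : x ∉ (φ i).range := hL.2 _ List.mem_cons_self
    rcases List.eq_nil_or_concat L with rfl | ⟨L, ⟨j, z⟩, rfl⟩
    · exact Or.inl ⟨i, φ i c * x, by rw [base_mul_listProd_cons, listProd_cons, listProd_nil, mul_one]⟩
    rw [List.concat_eq_append] at hL hn ⊢
    by_cases hij : i = j
    · subst hij
      have hr : IsReduced φ (⟨i, x⟩ :: L) := by
        refine ⟨?_, fun y hy => hL.2 y (by
          simp only [List.mem_cons, List.mem_append] at hy ⊢; tauto)⟩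
        have := hL.1
        rw [← List.cons_append, List.map_append, List.isChain_append] at this
        exact this.1
      have he : IsConj (PushoutI.of i (z * φ i c * x) * listProd φ L)
          (PushoutI.base φ c * listProd φ (⟨i, x⟩ :: (L ++ [⟨i, z⟩]))) :=
        isConj_iff.2 ⟨(PushoutI.of i z)⁻¹, by simp [PushoutI.of_apply_eq_base, mul_assoc]⟩
      by_cases hz : z * φ i c * x ∈ (φ i).range
      · obtain ⟨c', hc'⟩ := hz
        rw [← hc', PushoutI.of_apply_eq_base] at he
        rcases ih L.length (by simp at hn; omega) c' L hr.of_cons rfl with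
          ⟨k, y, h⟩ | ⟨M, hM, h⟩
        · exact Or.inl ⟨k, y, h.trans he⟩
        · exact Or.inr ⟨M, hM, h.trans he⟩
      · rcases ih (L.length + 1) (by simp at hn; omega) 1 (⟨i, z * φ i c * x⟩ :: L)
          (hr.cons_of_fst hz) (by simp) with ⟨k, y, h⟩ | ⟨M, hM, h⟩
        · exact Or.inl ⟨k, y, h.trans (by simpa using he)⟩
        · exact Or.inr ⟨M, hM, h.trans (by simpa using he)⟩
    · refine Or.inr ⟨⟨i, φ i c * x⟩ :: (L ++ [⟨j, z⟩]), ?_, ?_⟩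
      · rw [isCyclicList_cons]
        refine ⟨?_, mul_notMem_range_left c hx, hL.of_cons.2⟩
        rw [← List.cons_append, List.isChain_append]
        refine ⟨hL.1, by simp, ?_⟩
        simpa only [List.map_cons, List.map_append, List.map_nil, ← List.cons_append,
          List.getLast?_concat, List.head?_cons, Option.mem_some_iff, forall_eq'] using Ne.symm hij
      · rw [base_mul_listProd_cons]

end Conjugacy

end Amalgam

/-! ### Normal subgroups of `p`-power index -/

/-- A normal subgroup whose index is a power of `p`. -/
def IsPNormal (p : ℕ) {F : Type*} [Group F] (N : Subgroup F) : Prop :=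
  N.Normal ∧ ∃ j, N.index = p ^ j

namespace IsPNormal

variable {p : ℕ} {F : Type*} [Group F]

theorem of_relIndex (hp : p.Prime) {M N : Subgroup F} (hN : IsPNormal p N) (hM : M.Normal)
    (hMN : M ≤ N) {j : ℕ} (h : M.relIndex N ∣ p ^ j) : IsPNormal p M := by
  obtain ⟨k, -, hk⟩ := (Nat.dvd_prime_pow hp).1 h
  obtain ⟨l, hl⟩ := hN.2
  exact ⟨hM, k + l, by rw [← Subgroup.relIndex_mul_index hMN, hk, hl, pow_add]⟩

theorem inf (hp : p.Prime) {M N : Subgroup F} (hM : IsPNormal p M) (hN : IsPNormal p N) :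
    IsPNormal p (M ⊓ N) := by
  have := hM.1
  have := hN.1
  obtain ⟨j, hj⟩ := hM.2
  refine hN.of_relIndex hp inferInstance inf_le_right (j := j) ?_
  rw [Subgroup.inf_relIndex_right, ← hj]
  exact Subgroup.relIndex_dvd_index_of_normal _ _

theorem top : IsPNormal p (⊤ : Subgroup F) := ⟨inferInstance, 0, by simp⟩

theorem finite (hp : p.Prime) {N : Subgroup F} (hN : IsPNormal p N) : Finite (F ⧸ N) := by
  obtain ⟨j, hj⟩ := hN.2
  have : N.FiniteIndex := ⟨hj ▸ pow_ne_zero _ hp.ne_zero⟩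
  exact Subgroup.finite_quotient_of_finiteIndex

theorem isPGroup {N : Subgroup F} [N.Normal] (hN : IsPNormal p N) :
    IsPGroup p (F ⧸ N) := by
  obtain ⟨j, hj⟩ := hN.2
  exact IsPGroup.of_card hj

/-- The smallest power of an element that lies in a normal subgroup of `p`-power index. -/
theorem exists_zpow_mem_iff (hp : p.Prime) {N : Subgroup F} (hN : IsPNormal p N) (γ : F) :
    ∃ r : ℕ, ∀ a : ℤ, γ ^ a ∈ N ↔ ((p ^ r : ℕ) : ℤ) ∣ a := by
  have := hN.1
  obtain ⟨j, hj⟩ := hN.2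
  have h : orderOf (γ : F ⧸ N) ∣ p ^ j := hj ▸ orderOf_dvd_natCard _
  obtain ⟨r, -, hr⟩ := (Nat.dvd_prime_pow hp).1 h
  refine ⟨r, fun a => ?_⟩
  rw [← hr, orderOf_dvd_iff_zpow_eq_one, ← QuotientGroup.eq_one_iff, QuotientGroup.mk_zpow]

end IsPNormal

/-! ### Integer cocycles: `D z q` integrates a 1-cochain of the Cayley graph along the path of `z`
from `q` -/

/-- `D` is a cocycle of `F` with values in the integer functions on a quotient of `F`. -/
def IsCocycle {F Q : Type*} [Group F] [Group Q] (π : F →* Q) (D : F → Q → ℤ) : Prop :=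
  ∀ z w q, D (z * w) q = D z (π w * q) + D w q

namespace IsCocycle

variable {F Q : Type*} [Group F] [Group Q] {π : F →* Q} {D : F → Q → ℤ}

theorem map_one (hD : IsCocycle π D) (q : Q) : D 1 q = 0 := by
  simpa using hD 1 1 q

theorem map_inv (hD : IsCocycle π D) (z : F) (q : Q) : D z⁻¹ q = -D z (π z⁻¹ * q) := by
  have := hD z z⁻¹ q
  rw [mul_inv_cancel, hD.map_one] at this
  linarith

theorem map_mul_of_mem (hD : IsCocycle π D) (z : F) {w : F} (hw : w ∈ π.ker) (q : Q) :
    D (z * w) q = D z q + D w q := by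
  rw [hD, MonoidHom.mem_ker.1 hw, one_mul]

theorem map_pow (hD : IsCocycle π D) (z : F) (n : ℕ) (q : Q) :
    D (z ^ n) q = ∑ i ∈ Finset.range n, D z (π z ^ i * q) := by
  induction n generalizing q with
  | zero => simp [hD.map_one]
  | succ n ih =>
    rw [pow_succ, hD, ih, Finset.sum_range_succ']
    simp [pow_succ, mul_assoc]

theorem map_conj (hD : IsCocycle π D) (h : F) {z : F} (hz : z ∈ π.ker) (q : Q) :
    D (h * z * h⁻¹) q = D z (π h⁻¹ * q) := by
  rw [hD, hD.map_mul_of_mem _ hz, hD.map_inv]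
  ring

/-- The restriction of a cocycle to the kernel, as a homomorphism, modulo an integer. -/
def kerHom (hD : IsCocycle π D) (n : ℕ) : π.ker →* Multiplicative (Q → ZMod n) where
  toFun z := Multiplicative.ofAdd fun q => (D z q : ZMod n)
  map_one' := by
    ext
    simp [hD.map_one]
  map_mul' z w := by
    rw [← ofAdd_add]
    congr 1
    ext q
    simp [hD.map_mul_of_mem _ w.2]

theorem map_zpow_of_mem (hD : IsCocycle π D) {z : F} (hz : z ∈ π.ker) (a : ℤ) (q : Q) :
    D (z ^ a) q = a * D z q := by
  have h : ∀ n : ℕ, D (z ^ n) q = n * D z q := by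
    intro n
    rw [hD.map_pow]
    simp [MonoidHom.mem_ker.1 hz]
  obtain ⟨n, rfl | rfl⟩ := a.eq_nat_or_neg
  · simpa using h n
  · rw [zpow_neg, hD.map_inv]
    simp [h, MonoidHom.mem_ker.1 hz]

theorem map_zpow_mul_conj_mul (hD : IsCocycle π D) {z n : F} (hz : z ∈ π.ker) (hn : n ∈ π.ker)
    (u : F) (a b : ℤ) (q : Q) :
    D (z ^ a * (u * z ^ b * u⁻¹) * n) q = a * D z q + b * D z (π u⁻¹ * q) + D n q := by
  have hb : z ^ b ∈ π.ker := zpow_mem hz b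
  rw [hD.map_mul_of_mem _ hn, hD.map_mul_of_mem _ (π.normal_ker.conj_mem _ hb u),
    hD.map_conj _ hb, hD.map_zpow_of_mem hz, hD.map_zpow_of_mem hz]

/-- The elements of the kernel of `π` on which the cocycle vanishes modulo `n`. -/
def kerMod (hD : IsCocycle π D) (n : ℕ) : Subgroup F := (hD.kerHom n).ker.map π.ker.subtype

theorem mem_kerMod (hD : IsCocycle π D) {n : ℕ} {z : F} :
    z ∈ hD.kerMod n ↔ z ∈ π.ker ∧ ∀ q, (n : ℤ) ∣ D z q := by
  have h : ∀ z : π.ker, z ∈ (hD.kerHom n).ker ↔ ∀ q, (n : ℤ) ∣ D z q := fun z => by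
    rw [MonoidHom.mem_ker]
    change Multiplicative.ofAdd (fun q => (D z q : ZMod n)) = 1 ↔ _
    simp only [ofAdd_eq_one, funext_iff, Pi.zero_apply, ZMod.intCast_zmod_eq_zero_iff_dvd]
  constructor
  · rintro ⟨a, ha, rfl⟩
    exact ⟨a.2, (h a).1 ha⟩
  · rintro ⟨ha, hz⟩
    exact ⟨⟨z, ha⟩, (h _).2 hz, rfl⟩

/-- Conjugation only translates the argument `q`, whence normality. The index in `π.ker` divides the
order of the finite `p`-group `Q → ZMod (p ^ k)`. -/
theorem isPNormal_kerMod {p : ℕ} (hp : p.Prime) [Finite Q] (hD : IsCocycle π D)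
    (hN : IsPNormal p π.ker) (k : ℕ) : IsPNormal p (hD.kerMod (p ^ k)) := by
  have hle : hD.kerMod (p ^ k) ≤ π.ker := fun z hz => (hD.mem_kerMod.1 hz).1
  refine hN.of_relIndex hp ⟨fun z hz w => ?_⟩ hle (j := k * Nat.card Q) ?_
  · rw [hD.mem_kerMod] at hz ⊢
    refine ⟨hN.1.conj_mem z hz.1 w, fun q => ?_⟩
    rw [hD.map_conj _ hz.1]
    exact hz.2 _
  · have : NeZero (p ^ k) := ⟨pow_ne_zero _ hp.ne_zero⟩
    have h : (hD.kerMod (p ^ k)).subgroupOf π.ker = (hD.kerHom (p ^ k)).ker :=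
      Subgroup.comap_map_eq_self_of_injective π.ker.subtype_injective _
    rw [Subgroup.relIndex, h, Subgroup.index_ker]
    refine (Subgroup.card_subgroup_dvd_card _).trans ?_
    have hcard : Nat.card (Multiplicative (Q → ZMod (p ^ k))) = p ^ (k * Nat.card Q) := by
      rw [show Nat.card (Multiplicative (Q → ZMod (p ^ k))) = Nat.card (Q → ZMod (p ^ k)) from rfl,
        Nat.card_fun, Nat.card_zmod, pow_mul]
    rw [hcard]

end IsCocycle

/-! ### Separation of double cosets of a boundary element -/

open Classical in
/-- The properties of the boundary curve `γ` of a surface with one boundary component that give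
separation properties of the double cosets of `⟨γ⟩` in the pro-`p` topology. -/
structure IsBoundaryElement (p : ℕ) {F : Type*} [Group F] (γ : F) : Prop where
  exists_notMem : ∀ w : F, w ≠ 1 → ∃ N : Subgroup F, IsPNormal p N ∧ w ∉ N
  exists_zpow_mem_iff : ∀ r : ℕ, ∃ N : Subgroup F, IsPNormal p N ∧
    ∀ a : ℤ, γ ^ a ∈ N ↔ ((p ^ r : ℕ) : ℤ) ∣ a
  mem_zpowers_of_commute : ∀ h : F, Commute h γ → h ∈ Subgroup.zpowers γ
  -- The conditions on `v` keep the negative point `v` off the `γ`-orbits of `1` and of `h⁻¹` in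
  -- suitable quotients, so that it does not contribute to the sums of `D γ` over them.
  exists_cocycle : ∀ h : F, h ∉ Subgroup.zpowers γ → ∃ v : F, v ∉ Subgroup.zpowers γ ∧
    v * h ∉ Subgroup.zpowers γ ∧ ∀ N : Subgroup F, ∀ _ : N.Normal, ∃ D : F → F ⧸ N → ℤ,
      IsCocycle (QuotientGroup.mk' N) D ∧
      ∀ q, D γ q = (if q = 1 then 1 else 0) - (if q = (v : F ⧸ N) then 1 else 0)

namespace IsBoundaryElement

variable {p : ℕ} {F : Type*} [Group F] {γ : F}

/-- Since `h` does not commute with `γ`, their commutator survives in some `p`-quotient; there the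
image of `h` cannot be a power of that of `γ`. -/
theorem exists_forall_zpow_mul_notMem (hγ : IsBoundaryElement p γ) {h : F}
    (hh : h ∉ Subgroup.zpowers γ) :
    ∃ N : Subgroup F, IsPNormal p N ∧ ∀ a : ℤ, γ ^ a * h ∉ N := by
  have hc : h * γ * h⁻¹ * γ⁻¹ ≠ 1 := by
    intro h1
    exact hh (hγ.mem_zpowers_of_commute h (by
      rwa [mul_inv_eq_one, mul_inv_eq_iff_eq_mul] at h1))
  obtain ⟨N, hN, hcN⟩ := hγ.exists_notMem _ hc
  refine ⟨N, hN, fun a ha => hcN ?_⟩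
  have := hN.1
  rw [← QuotientGroup.eq_one_iff] at ha ⊢
  have hh' : (h : F ⧸ N) = (γ : F ⧸ N) ^ (-a) := by
    rw [zpow_neg, eq_inv_iff_mul_eq_one, mul_eq_one_comm]
    exact ha
  simp only [QuotientGroup.mk_mul, QuotientGroup.mk_inv, hh']
  group

/-- In a small enough normal subgroup `N` of `p`-power index, the boundary curves `γ ^ R` and
`h * γ ^ R * h⁻¹` of the corresponding cover are independent in homology. -/
theorem exists_isPNormal_cocycle (hp : p.Prime) (hγ : IsBoundaryElement p γ) {h : F}
    (hh : h ∉ Subgroup.zpowers γ) :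
    ∃ N₀ : Subgroup F, IsPNormal p N₀ ∧
      ∀ N ≤ N₀, IsPNormal p N → ∀ r : ℕ, (∀ a : ℤ, γ ^ a ∈ N ↔ ((p ^ r : ℕ) : ℤ) ∣ a) →
        ∃ (_ : N.Normal) (D : F → F ⧸ N → ℤ), IsCocycle (QuotientGroup.mk' N) D ∧
          D (γ ^ p ^ r) 1 = 1 ∧ D (γ ^ p ^ r) (h⁻¹ : F) = 0 := by
  obtain ⟨v, hv, hvh, hcoc⟩ := hγ.exists_cocycle h hh
  obtain ⟨N₁, hN₁, h₁⟩ := hγ.exists_forall_zpow_mul_notMem hh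
  obtain ⟨N₂, hN₂, h₂⟩ := hγ.exists_forall_zpow_mul_notMem hv
  obtain ⟨N₃, hN₃, h₃⟩ := hγ.exists_forall_zpow_mul_notMem hvh
  -- The value on `γ ^ p ^ r` at `q` is the sum of `D γ` over the points `γ ^ i * q`. From `q = 1`
  -- the orbit meets `1` once and avoids `v` (by `N₂`); from `q = h⁻¹` it avoids `1` (by `N₁`) and
  -- `v` (by `N₃`).
  refine ⟨N₁ ⊓ N₂ ⊓ N₃, (hN₁.inf hp hN₂).inf hp hN₃, fun N hle hN r hr => ?_⟩
  have hn := hN.1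
  obtain ⟨D, hD, hDγ⟩ := hcoc N hn
  have mk_pow : ∀ i : ℕ, QuotientGroup.mk' N γ ^ i = ((γ ^ i : F) : F ⧸ N) := fun i => by simp
  refine ⟨hn, D, hD, ?_, ?_⟩
  · rw [hD.map_pow, Finset.sum_eq_single_of_mem 0 (by simp [hp.pos])]
    · have : (1 : F ⧸ N) ≠ v := by
        intro h1
        rw [eq_comm, QuotientGroup.eq_one_iff] at h1
        exact h₂ 0 (by simpa using (hle h1).1.2)
      simp [hDγ, this]
    · intro i hi hi0
      rw [Finset.mem_range] at hi
      rw [hDγ, mul_one, mk_pow, if_neg, if_neg, sub_zero]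
      · intro h1
        rw [QuotientGroup.eq] at h1
        exact h₂ (-i) (by simpa using (hle h1).1.2)
      · rw [QuotientGroup.eq_one_iff, ← zpow_natCast, hr, Int.natCast_dvd_natCast]
        exact fun hd => hi0 (Nat.eq_zero_of_dvd_of_lt hd hi)
  · rw [hD.map_pow]
    refine Finset.sum_eq_zero fun i _ => ?_
    rw [hDγ, mk_pow, ← QuotientGroup.mk_mul, if_neg, if_neg, sub_zero]
    · intro h1
      rw [QuotientGroup.eq] at h1
      refine h₃ (-i) ?_
      have := (hle (hn.conj_mem _ h1 h⁻¹)).2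
      simpa [mul_assoc] using this
    · rw [QuotientGroup.eq_one_iff]
      intro h1
      refine h₁ (-i) ?_
      have := (hle (hn.conj_mem _ (inv_mem h1) h⁻¹)).1.1
      simpa [mul_assoc] using this

/-- The images of `⟨γ⟩` and `h * ⟨γ⟩ * h⁻¹` are made to meet trivially by passing to `kerMod`. The
exponent `K + 1` rather than `K` leaves a spare factor `p` even for `K = 0`; it is used in
`hcancel`. -/
theorem exists_isPNormal_le (hp : p.Prime) (hγ : IsBoundaryElement p γ) {h : F}
    (hh : h ∉ Subgroup.zpowers γ) {N₀ : Subgroup F} (hN₀ : IsPNormal p N₀) (K : ℕ) :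
    ∃ N ≤ N₀, IsPNormal p N ∧ ∃ r, K ≤ r ∧ (∀ a : ℤ, γ ^ a ∈ N ↔ ((p ^ r : ℕ) : ℤ) ∣ a) ∧
      ∀ a b : ℤ, γ ^ a * (h * γ ^ b * h⁻¹) ∈ N →
        ((p ^ r : ℕ) : ℤ) ∣ a ∧ ((p ^ r : ℕ) : ℤ) ∣ b := by
  obtain ⟨N₁, hN₁, hcoc⟩ := hγ.exists_isPNormal_cocycle hp hh
  have hN := hN₀.inf hp hN₁
  obtain ⟨r, hr⟩ := hN.exists_zpow_mem_iff hp γ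
  obtain ⟨hn, D, hD, hD₁, hDh⟩ := hcoc _ inf_le_right hN r hr
  have hfin := hN.finite hp
  have hker : IsPNormal p (QuotientGroup.mk' (N₀ ⊓ N₁)).ker := by
    rwa [QuotientGroup.ker_mk']
  have hmem : ∀ {z : F}, z ∈ hD.kerMod (p ^ (K + 1)) ↔
      z ∈ N₀ ⊓ N₁ ∧ ∀ q, ((p ^ (K + 1) : ℕ) : ℤ) ∣ D z q := fun {z} => by
    rw [hD.mem_kerMod, QuotientGroup.ker_mk']
  have hz : γ ^ p ^ r ∈ (QuotientGroup.mk' (N₀ ⊓ N₁)).ker := by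
    rw [QuotientGroup.ker_mk', ← zpow_natCast, hr]
  have hM := hD.isPNormal_kerMod hp hker (K + 1)
  have hMn := hM.1
  have hpow : ∀ a : ℤ, γ ^ (((p ^ r : ℕ) : ℤ) * a) = (γ ^ p ^ r) ^ a := fun a => by
    rw [zpow_mul, zpow_natCast]
  have hsplit : ((p ^ (r + (K + 1)) : ℕ) : ℤ) = ((p ^ r : ℕ) : ℤ) * ((p ^ (K + 1) : ℕ) : ℤ) := by
    rw [pow_add, Nat.cast_mul]
  have hdirect : ∀ a b : ℤ, γ ^ a * (h * γ ^ b * h⁻¹) ∈ hD.kerMod (p ^ (K + 1)) →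
      ((p ^ r : ℕ) : ℤ) ∣ a → ((p ^ r : ℕ) : ℤ) ∣ b →
      ((p ^ (r + (K + 1)) : ℕ) : ℤ) ∣ a ∧ ((p ^ (r + (K + 1)) : ℕ) : ℤ) ∣ b := by
    rintro _ _ hab ⟨a, rfl⟩ ⟨b, rfl⟩
    rw [hpow, hpow] at hab
    have hD' := fun q => hD.map_zpow_mul_conj_mul hz (one_mem _) h a b q
    -- Evaluation at `q = 1` and `q = h` gives a triangular system for `a` and `b` with ones on the
    -- diagonal.
    simp only [mul_one, hD.map_one, add_zero] at hD'
    have hq := fun q => hD' q ▸ (hmem.1 hab).2 q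
    have ha : ((p ^ (K + 1) : ℕ) : ℤ) ∣ a := by
      have := hq 1
      rw [mul_one, hD₁, QuotientGroup.mk'_apply, hDh] at this
      simpa using this
    have hb : ((p ^ (K + 1) : ℕ) : ℤ) ∣ b := by
      have := hq (h : F)
      rw [QuotientGroup.mk'_apply, ← QuotientGroup.mk_mul, inv_mul_cancel, QuotientGroup.mk_one,
        hD₁, mul_one] at this
      exact (dvd_add_right (dvd_mul_of_dvd_left ha _)).1 this
    rw [hsplit]
    exact ⟨mul_dvd_mul_left _ ha, mul_dvd_mul_left _ hb⟩
  -- To drop the divisibility assumed in `hdirect`, raise the relation to the `p`-th power: the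
  -- induction applies to `p * a`, `p * b`, and cancelling one `p` still leaves `p ^ r` dividing `a`
  -- and `b`.
  have hstep : ∀ (m : ℕ) (a b : ℤ), γ ^ a * (h * γ ^ b * h⁻¹) ∈ hD.kerMod (p ^ (K + 1)) →
      ((p ^ r : ℕ) : ℤ) ∣ (p : ℤ) ^ m * a → ((p ^ r : ℕ) : ℤ) ∣ (p : ℤ) ^ m * b →
      ((p ^ (r + (K + 1)) : ℕ) : ℤ) ∣ a ∧ ((p ^ (r + (K + 1)) : ℕ) : ℤ) ∣ b := by
    intro m
    induction m with
    | zero => simpa using hdirect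
    | succ m ih =>
      intro a b hab ha hb
      have hab' : γ ^ (p * a) * (h * γ ^ (p * b) * h⁻¹) ∈ hD.kerMod (p ^ (K + 1)) := by
        rw [← QuotientGroup.eq_one_iff] at hab ⊢
        rw [QuotientGroup.mk_mul, mul_eq_one_iff_eq_inv, ← QuotientGroup.mk_inv] at hab
        have := congrArg (· ^ p) hab
        rw [← QuotientGroup.mk_pow, ← QuotientGroup.mk_pow, inv_pow, conj_pow, ← zpow_natCast,
          ← zpow_natCast, ← zpow_mul, ← zpow_mul] at this
        rw [QuotientGroup.mk_mul, mul_eq_one_iff_eq_inv, ← QuotientGroup.mk_inv, mul_comm (p : ℤ) a,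
          mul_comm (p : ℤ) b, this]
      obtain ⟨ha', hb'⟩ := ih _ _ hab' (by rwa [← mul_assoc, ← pow_succ])
        (by rwa [← mul_assoc, ← pow_succ])
      have hcancel : ∀ c : ℤ, ((p ^ (r + (K + 1)) : ℕ) : ℤ) ∣ p * c → ((p ^ r : ℕ) : ℤ) ∣ c := by
        intro c hc
        rw [← add_assoc, pow_succ', Nat.cast_mul] at hc
        refine dvd_trans ?_ (Int.dvd_of_mul_dvd_mul_left (by exact_mod_cast hp.ne_zero) hc)
        exact Int.natCast_dvd_natCast.2 (pow_dvd_pow p (Nat.le_add_right r K))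
      exact hdirect a b hab (hcancel a ha') (hcancel b hb')
  refine ⟨hD.kerMod (p ^ (K + 1)), fun z hz => (hmem.1 hz).1.1, hM, r + (K + 1), by omega,
    fun a => ⟨fun ha => ?_, fun ha => ?_⟩, fun a b hab => ?_⟩
  · obtain ⟨a, rfl⟩ := (hr a).1 (hmem.1 ha).1
    exact (hdirect _ 0 (by simpa using ha) ⟨a, rfl⟩ (dvd_zero _)).1
  · rw [hsplit] at ha
    obtain ⟨a, rfl⟩ := ha
    rw [hmem, hr, mul_assoc]
    refine ⟨dvd_mul_right _ _, fun q => ?_⟩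
    rw [hpow, hD.map_zpow_of_mem hz, mul_assoc]
    exact dvd_mul_right _ _
  · exact hstep r a b hab (by push_cast; exact dvd_mul_right _ _)
      (by push_cast; exact dvd_mul_right _ _)

/-- Double cosets of `⟨γ⟩` are closed in the pro-`p` topology. -/
theorem exists_forall_notMem (hp : p.Prime) (hγ : IsBoundaryElement p γ) {h g : F}
    (hh : h ∉ Subgroup.zpowers γ) (hg : ∀ a b : ℤ, γ ^ a * h * γ ^ b ≠ g) :
    ∃ N : Subgroup F, IsPNormal p N ∧ ∀ a b : ℤ, γ ^ a * h * γ ^ b * g⁻¹ ∉ N := by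
  obtain ⟨N₁, hN₁, hcoc⟩ := hγ.exists_isPNormal_cocycle hp hh
  obtain ⟨N, hle, hN, r, -, hr, hinj⟩ := hγ.exists_isPNormal_le hp hh hN₁ 0
  by_cases hsol : ∃ a b : ℤ, γ ^ a * h * γ ^ b * g⁻¹ ∈ N
  swap
  · push Not at hsol
    exact ⟨N, hN, hsol⟩
  obtain ⟨a₀, b₀, h₀⟩ := hsol
  obtain ⟨hn, D, hD, hD₁, hDh⟩ := hcoc N hle hN r hr
  have hfin := hN.finite hp
  have hker : IsPNormal p (QuotientGroup.mk' N).ker := by rwa [QuotientGroup.ker_mk']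
  have hz : γ ^ p ^ r ∈ (QuotientGroup.mk' N).ker := by
    rw [QuotientGroup.ker_mk', ← zpow_natCast, hr]
  have h₀' : γ ^ a₀ * h * γ ^ b₀ * g⁻¹ ∈ (QuotientGroup.mk' N).ker := by
    rwa [QuotientGroup.ker_mk']
  have hpow : ∀ a : ℤ, γ ^ (((p ^ r : ℕ) : ℤ) * a) = (γ ^ p ^ r) ^ a := fun a => by
    rw [zpow_mul, zpow_natCast]
  have hDinv : D (γ ^ p ^ r) ((γ ^ a₀ : F) : F ⧸ N) = 1 := by
    have h1 := hD.map_conj (γ ^ a₀) hz ((γ ^ a₀ : F) : F ⧸ N)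
    have h2 : γ ^ a₀ * γ ^ p ^ r * (γ ^ a₀)⁻¹ = γ ^ p ^ r := by group
    rw [h2, QuotientGroup.mk'_apply, ← QuotientGroup.mk_mul, inv_mul_cancel, QuotientGroup.mk_one,
      hD₁] at h1
    exact h1
  -- By `hinj` all solutions modulo `N` are `a₀ + p ^ r * a'`, `b₀ + p ^ r * b'`. The cocycle at `γ
  -- ^ a₀` and at `γ ^ a₀ * h` forces `a' ≡ α` and `b' ≡ β` modulo `p ^ k`. The single pair `(α, β)`
  -- gives no true solution, so a subgroup `R` excludes it; `k` is taken so that `γ ^ p ^ k` lies in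
  -- `R`.
  set n := γ ^ a₀ * h * γ ^ b₀ * g⁻¹ with hn_def
  set α : ℤ := -D n ((γ ^ a₀ : F) : F ⧸ N) with hα
  set β : ℤ := -D n ((γ ^ a₀ * h : F) : F ⧸ N) -
    α * D (γ ^ p ^ r) ((γ ^ a₀ * h : F) : F ⧸ N) with hβ
  obtain ⟨R, hR, hnotR⟩ := hγ.exists_notMem
    (γ ^ (a₀ + ((p ^ r : ℕ) : ℤ) * α) * h * γ ^ (b₀ + ((p ^ r : ℕ) : ℤ) * β) * g⁻¹)
    (fun h1 => hg _ _ (mul_inv_eq_one.1 h1))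
  obtain ⟨k, hk⟩ := hR.exists_zpow_mem_iff hp γ
  refine ⟨hD.kerMod (p ^ k) ⊓ R, (hD.isPNormal_kerMod hp hker k).inf hp hR, ?_⟩
  intro a b hab
  obtain ⟨hab, habR⟩ := Subgroup.mem_inf.1 hab
  rw [hD.mem_kerMod, QuotientGroup.ker_mk'] at hab
  have hdvd := hinj (a - a₀) (b - b₀) (by
    have h1 := hab.1
    have h2 := hn.conj_mem _ (N.mul_mem h1 (N.inv_mem h₀)) (γ ^ (-a₀))
    have h3 : γ ^ (-a₀) * (γ ^ a * h * γ ^ b * g⁻¹ * n⁻¹) * (γ ^ (-a₀))⁻¹ =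
      γ ^ (a - a₀) * (h * γ ^ (b - b₀) * h⁻¹) := by
      rw [hn_def]; group
    rwa [h3] at h2)
  obtain ⟨⟨a', ha'⟩, ⟨b', hb'⟩⟩ := hdvd
  obtain rfl : a = a₀ + ((p ^ r : ℕ) : ℤ) * a' := by rw [← ha']; ring
  obtain rfl : b = b₀ + ((p ^ r : ℕ) : ℤ) * b' := by rw [← hb']; ring
  have heq : γ ^ (a₀ + ((p ^ r : ℕ) : ℤ) * a') * h * γ ^ (b₀ + ((p ^ r : ℕ) : ℤ) * b') * g⁻¹ =
      (γ ^ p ^ r) ^ a' * ((γ ^ a₀ * h) * (γ ^ p ^ r) ^ b' * (γ ^ a₀ * h)⁻¹) * n := by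
    rw [← hpow, ← hpow, hn_def]; group
  have hq := hab.2
  rw [heq] at hq
  simp only [hD.map_zpow_mul_conj_mul hz h₀'] at hq
  have ha : ((p ^ k : ℕ) : ℤ) ∣ a' - α := by
    have := hq ((γ ^ a₀ : F) : F ⧸ N)
    rw [hDinv, QuotientGroup.mk'_apply, ← QuotientGroup.mk_mul,
      show (γ ^ a₀ * h)⁻¹ * γ ^ a₀ = h⁻¹ by group, hDh] at this
    rw [hα]
    convert this using 1
    ring
  have hb : ((p ^ k : ℕ) : ℤ) ∣ b' - β := by
    have := hq ((γ ^ a₀ * h : F) : F ⧸ N)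
    rw [QuotientGroup.mk'_apply, ← QuotientGroup.mk_mul, inv_mul_cancel, QuotientGroup.mk_one,
      hD₁] at this
    have h2 := dvd_sub this (dvd_mul_of_dvd_left ha (D (γ ^ p ^ r) ((γ ^ a₀ * h : F) : F ⧸ N)))
    have h3 : b' - β = a' * D (γ ^ p ^ r) ((γ ^ a₀ * h : F) : F ⧸ N) + b' * 1 +
        D n ((γ ^ a₀ * h : F) : F ⧸ N) - (a' - α) * D (γ ^ p ^ r) ((γ ^ a₀ * h : F) : F ⧸ N) := by
      rw [hβ]
      ring
    rw [h3]
    exact h2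
  have hγa : γ ^ (((p ^ r : ℕ) : ℤ) * (a' - α)) ∈ R := (hk _).2 (dvd_mul_of_dvd_right ha _)
  have hγb : γ ^ (((p ^ r : ℕ) : ℤ) * (b' - β)) ∈ R := (hk _).2 (dvd_mul_of_dvd_right hb _)
  apply hnotR
  have hRn := hR.1
  have h1 := R.mul_mem (R.mul_mem (R.inv_mem hγa) habR) (hRn.conj_mem _ (R.inv_mem hγb) g)
  convert h1 using 1
  group

/-- Separation of a letter `x` from a double coset `⟨γ⟩ y ⟨γ⟩`, and of the elements of `⟨γ⟩` that
carry one to the other. -/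
theorem exists_zpow_eq (hp : p.Prime) (hγ : IsBoundaryElement p γ) {x : F}
    (hx : x ∉ Subgroup.zpowers γ) (y : F) :
    ∃ a₀ b₀ : ℤ, ∀ K : ℕ, ∃ N : Subgroup F, IsPNormal p N ∧
      ∀ a b : ℤ, γ ^ a * x * γ ^ (-b) * y⁻¹ ∈ N →
        γ ^ a₀ * x = y * γ ^ b₀ ∧ ((p ^ K : ℕ) : ℤ) ∣ a - a₀ ∧ ((p ^ K : ℕ) : ℤ) ∣ b - b₀ := by
  by_cases hsol : ∃ a b : ℤ, γ ^ a * x * γ ^ b = y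
  · obtain ⟨a₀, b₀, rfl⟩ := hsol
    refine ⟨a₀, -b₀, fun K => ?_⟩
    obtain ⟨N, -, hN, r, hr, -, hinj⟩ := hγ.exists_isPNormal_le hp hx (IsPNormal.top (p := p)) K
    refine ⟨N, hN, fun a b hab => ?_⟩
    have := hinj (a - a₀) (-b - b₀) (by
      have h1 := hN.1.conj_mem _ hab (γ ^ (-a₀))
      convert h1 using 1
      group)
    have hd : ((p ^ K : ℕ) : ℤ) ∣ ((p ^ r : ℕ) : ℤ) :=
      Int.natCast_dvd_natCast.2 (pow_dvd_pow p hr)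
    refine ⟨by group, hd.trans this.1, ?_⟩
    have h2 := hd.trans this.2
    rwa [← dvd_neg, neg_sub, sub_neg_eq_add, add_comm, ← sub_neg_eq_add] at h2
  · push Not at hsol
    obtain ⟨N, hN, h⟩ := hγ.exists_forall_notMem hp hx hsol
    -- Placeholders: no exponents satisfy the condition modulo `N`.
    exact ⟨0, 0, fun _ => ⟨N, hN, fun a b hab => absurd hab (h _ _)⟩⟩

end IsBoundaryElement

/-! ### Free groups: cocycles, residual `p`-finiteness, boundary elements -/

namespace FreeGroup

variable {X : Type*}

/-- Cocycles on a free group can be prescribed on the generators. -/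
theorem exists_isCocycle {Q : Type*} [Group Q] (π : FreeGroup X →* Q) (m : X → Q → ℤ) :
    ∃ D : FreeGroup X → Q → ℤ, IsCocycle π D ∧ ∀ x q, D (of x) q = m x q := by
  -- Skew product: each generator permutes `Q × ℤ`, shifting the second coordinate by its prescribed
  -- value. Freeness extends this to an action, whose shift is the cocycle.
  let e : X → Equiv.Perm (Q × ℤ) := fun x =>
    { toFun := fun q => (π (of x) * q.1, m x q.1 + q.2)
      invFun := fun q => ((π (of x))⁻¹ * q.1, -m x ((π (of x))⁻¹ * q.1) + q.2)
      left_inv := fun q => by simp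
      right_inv := fun q => by simp }
  let Φ : FreeGroup X →* Equiv.Perm (Q × ℤ) := lift e
  have key : ∀ z q n, Φ z (q, n) = (π z * q, (Φ z (q, 0)).2 + n) := by
    intro z
    induction z using FreeGroup.induction_on with
    | C1 => simp
    | of x => simp [Φ, e]
    | inv_of x hx =>
      intro q n
      simp only [_root_.map_inv, Equiv.Perm.inv_def]
      simp [Φ, e]
    | mul x y hx hy =>
      intro q n
      have h0 := hy q 0
      rw [add_zero] at h0
      rw [_root_.map_mul, Equiv.Perm.mul_apply, Equiv.Perm.mul_apply, hy, h0, hx,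
        hx _ ((Φ y (q, 0)).2)]
      simp [mul_assoc, add_assoc]
  refine ⟨fun z q => (Φ z (q, 0)).2, fun z w q => ?_, fun x q => by simp [Φ, e]⟩
  have h0 := key w q 0
  rw [add_zero] at h0
  simp only [_root_.map_mul, Equiv.Perm.mul_apply]
  rw [h0, key]

/-- Free groups are residually finite `p`-groups; more precisely, all the suffixes of a reduced word
are distinguished by a finite `p`-quotient. -/
theorem exists_isPNormal_suffix {p : ℕ} (hp : p.Prime) {L : List (X × Bool)} (hL : IsReduced L) :
    ∃ N : Subgroup (FreeGroup X), IsPNormal p N ∧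
      ∀ s t, s <:+ L → t <:+ L → (mk s)⁻¹ * mk t ∈ N → s = t := by
  classical
  induction L with
  | nil =>
    refine ⟨⊤, IsPNormal.top, fun s t hs ht _ => ?_⟩
    rw [List.suffix_nil.1 hs, List.suffix_nil.1 ht]
  | cons a L ih =>
    obtain ⟨N, hN, hsep⟩ := ih (List.IsChain.tail hL)
    have hn := hN.1
    have hfin := hN.finite hp
    have hker : IsPNormal p (QuotientGroup.mk' N).ker := by rwa [QuotientGroup.ker_mk']
    have hmk : ∀ (b : X × Bool) (t : List (X × Bool)),
        mk (b :: t) = mk [b] * mk t := fun b t => by rw [mul_mk]; rfl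
    have hsep' : ∀ s t, s <:+ L → t <:+ L → (mk s : FreeGroup X ⧸ N) = mk t → s = t :=
      fun s t hs ht h => hsep s t hs ht (QuotientGroup.eq.1 h)
    -- `q₀` is the origin of the Cayley graph edge that the letter `a` crosses after `L`; for an
    -- inverse letter this is the end of the path. `D` will be the indicator of that edge.
    obtain ⟨q₀, hq₀, hq₀'⟩ : ∃ q₀ : FreeGroup X ⧸ N, (a.2 = true → q₀ = (mk L : FreeGroup X)) ∧
        (a.2 = false → q₀ = (mk [a] * mk L : FreeGroup X)) := by
      rcases a with ⟨x, _ | _⟩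
      exacts [⟨_, by simp, fun _ => rfl⟩, ⟨_, fun _ => rfl, by simp⟩]
    obtain ⟨D, hD, hDm⟩ := exists_isCocycle (QuotientGroup.mk' N)
      (fun x q => if x = a.1 ∧ q = q₀ then 1 else 0)
    have htrue : ∀ x q, D (mk [(x, true)]) q = if x = a.1 ∧ q = q₀ then 1 else 0 := hDm
    have hfalse : ∀ x q, D (mk [(x, false)]) q =
        -if x = a.1 ∧ (mk [(x, false)] : FreeGroup X) * q = q₀ then 1 else 0 := by
      intro x q
      have h1 : mk [(x, false)] = (of x)⁻¹ := rfl
      rw [h1, hD.map_inv, hDm]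
      rfl
    -- The path of `L` never crosses this edge: its vertices are distinct modulo `N`, so a crossing
    -- in the same direction would make a proper suffix equal to `L`, and one in the opposite
    -- direction would make `a` cancel the first letter of `L`.
    have hDL : ∀ t, t <:+ L → D (mk t) 1 = 0 := by
      intro t
      induction t with
      | nil => exact fun _ => hD.map_one 1
      | cons b t iht =>
        intro ht
        have ht' : t <:+ L := (List.suffix_cons b t).trans ht
        rw [hmk, hD, iht ht', add_zero, mul_one, QuotientGroup.mk'_apply]
        obtain ⟨x, _ | _⟩ := b
        · rw [hfalse, if_neg, neg_zero]
          rintro ⟨rfl, hq⟩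
          rcases h2 : a.2 with _ | _
          · rw [hq₀' h2, ← QuotientGroup.mk_mul, ← h2, QuotientGroup.mk_mul, QuotientGroup.mk_mul,
              mul_right_inj] at hq
            obtain rfl := hsep' _ _ ht' List.suffix_rfl hq
            simpa using ht.length_le
          · rw [hq₀ h2, ← QuotientGroup.mk_mul, ← hmk] at hq
            obtain rfl := hsep' _ _ ht List.suffix_rfl hq
            simp [isReduced_cons_cons, h2] at hL
        · rw [htrue, if_neg]
          rintro ⟨rfl, hq⟩
          rcases h2 : a.2 with _ | _
          · have h3 : mk [(a.1, true)] * mk [a] = (1 : FreeGroup X) := by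
              have h4 : mk [a] = (of a.1)⁻¹ := by
                rw [← Prod.mk.eta (p := a), h2]; rfl
              rw [h4]
              exact mul_inv_cancel (of a.1)
            have h5 : ((mk ((a.1, true) :: t) : FreeGroup X) : FreeGroup X ⧸ N) = mk L := by
              rw [hmk, QuotientGroup.mk_mul, hq, hq₀' h2, ← QuotientGroup.mk_mul, ← mul_assoc, h3,
                one_mul]
            obtain rfl := hsep' _ _ ht List.suffix_rfl h5
            simp [isReduced_cons_cons, h2] at hL
          · rw [hq₀ h2] at hq
            obtain rfl := hsep' _ _ ht' List.suffix_rfl hq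
            simpa using ht.length_le
    have hDa : D (mk (a :: L)) 1 = 1 ∨ D (mk (a :: L)) 1 = -1 := by
      rw [hmk, hD, hDL L List.suffix_rfl, add_zero, mul_one, QuotientGroup.mk'_apply]
      rcases a with ⟨x, _ | _⟩
      · right
        rw [hfalse, if_pos ⟨rfl, by rw [hq₀' rfl, QuotientGroup.mk_mul]⟩]
      · left
        rw [htrue, if_pos ⟨rfl, (hq₀ rfl).symm⟩]
    have hne : ∀ t, t <:+ L → (mk t)⁻¹ * mk (a :: L) ∉ hD.kerMod (p ^ 1) := by
      intro t ht hmem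
      rw [hD.mem_kerMod] at hmem
      have h1 : mk (a :: L) = mk t * ((mk t)⁻¹ * mk (a :: L)) := by group
      have h2 := hD.map_mul_of_mem (mk t) hmem.1 1
      rw [← h1, hDL t ht, zero_add] at h2
      have h3 := h2 ▸ hmem.2 1
      have h4 : ((p ^ 1 : ℕ) : ℤ) ∣ 1 := by
        rcases hDa with h | h <;> rw [h] at h3
        · exact h3
        · simpa using h3
      have h5 := Int.natCast_dvd_natCast.1 h4
      simp [hp.ne_one] at h5
    refine ⟨hD.kerMod (p ^ 1), hD.isPNormal_kerMod hp hker 1, fun s t hs ht hst => ?_⟩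
    rcases List.suffix_cons_iff.1 hs with rfl | hs <;> rcases List.suffix_cons_iff.1 ht with rfl | ht
    · rfl
    · refine absurd ?_ (hne t ht)
      simpa using inv_mem hst
    · exact absurd hst (hne s hs)
    · refine hsep s t hs ht ?_
      rw [hD.mem_kerMod, QuotientGroup.ker_mk'] at hst
      exact hst.1

theorem exists_isPNormal_notMem {p : ℕ} (hp : p.Prime) {w : FreeGroup X} (hw : w ≠ 1) :
    ∃ N : Subgroup (FreeGroup X), IsPNormal p N ∧ w ∉ N := by
  classical
  obtain ⟨N, hN, h⟩ := exists_isPNormal_suffix hp (isReduced_toWord (x := w))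
  refine ⟨N, hN, fun hmem => hw ?_⟩
  have := h [] w.toWord (List.nil_suffix) List.suffix_rfl (by
    rw [mk_toWord, ← one_eq_mk]; simpa using hmem)
  rw [← mk_toWord (x := w), ← this, one_eq_mk]

theorem subsingleton_of_forall_commute (h : ∀ z w : FreeGroup X, Commute z w) :
    Subsingleton X := by
  classical
  refine ⟨fun a b => ?_⟩
  by_contra hab
  have := congrArg (lift fun x => if x = a then Equiv.swap (0 : Fin 3) 1 else Equiv.swap 1 2)
    (h (of a) (of b)).eq
  simp only [_root_.map_mul, lift_apply_of, if_true, if_neg (Ne.symm hab)] at this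
  exact absurd this (by decide)

theorem isCyclic_of_forall_commute {H : Type*} [Group H] [IsFreeGroup H]
    (h : ∀ z w : H, Commute z w) : IsCyclic H := by
  let e := IsFreeGroup.toFreeGroup H
  have hs : Subsingleton (IsFreeGroup.Generators H) :=
    subsingleton_of_forall_commute fun z w => by
      simpa using (h (e.symm z) (e.symm w)).map e
  have hc : IsCyclic (FreeGroup (IsFreeGroup.Generators H)) := by
    rcases isEmpty_or_nonempty (IsFreeGroup.Generators H) with hE | ⟨⟨a⟩⟩
    · infer_instance
    · have : Unique (IsFreeGroup.Generators H) := ⟨⟨a⟩, fun _ => Subsingleton.elim _ _⟩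
      infer_instance
  exact isCyclic_of_surjective e.symm e.symm.surjective

/-- Commuting elements of a free group are powers of a common element. -/
theorem exists_zpow_eq_of_commute {g h : FreeGroup X} (hgh : Commute g h) :
    ∃ (z : FreeGroup X) (a b : ℤ), z ^ a = g ∧ z ^ b = h := by
  have hcomm : ∀ z w : Subgroup.closure {g, h}, Commute z w := by
    intro z w
    have := Subgroup.isMulCommutative_closure (k := {g, h}) (by
      rintro x (rfl | rfl) y (rfl | rfl)
      exacts [rfl, hgh, hgh.symm, rfl])
    exact this.is_comm.comm z w
  -- The subgroup is free by Nielsen–Schreier; being commutative, it is cyclic.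
  have := isCyclic_of_forall_commute hcomm
  obtain ⟨z, hz⟩ := this.exists_generator
  obtain ⟨a, ha⟩ := hz ⟨g, Subgroup.subset_closure (by simp)⟩
  obtain ⟨b, hb⟩ := hz ⟨h, Subgroup.subset_closure (by simp)⟩
  exact ⟨z, a, b, by simpa using congrArg Subtype.val ha, by simpa using congrArg Subtype.val hb⟩

open Classical in
/-- Cocycles whose value on `[x, y] * δ` is the difference of the indicator functions of two
points. -/
theorem exists_isCocycle_commutator {Q : Type*} [Group Q] (π : FreeGroup X →* Q) {x y : X}
    (hxy : x ≠ y) {δ : FreeGroup X} (hδ : δ ∈ Subgroup.closure (of '' {x, y}ᶜ)) {v : FreeGroup X}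
    (hv : v = δ⁻¹ * of y * (of x)⁻¹ * (of y)⁻¹ * δ ∨
      v = δ⁻¹ * of y * of x * of y * (of x)⁻¹ * (of y)⁻¹ * δ) :
    ∃ D : FreeGroup X → Q → ℤ, IsCocycle π D ∧
      ∀ q, D (of x * of y * (of x)⁻¹ * (of y)⁻¹ * δ) q =
        (if q = 1 then 1 else 0) - if q = π v then 1 else 0 := by
  have hcocδ : ∀ {D : FreeGroup X → Q → ℤ}, IsCocycle π D →
      (∀ z, z ≠ x → z ≠ y → ∀ q, D (of z) q = 0) → ∀ q, D δ q = 0 := by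
    clear hv
    intro D hD h0
    induction hδ using Subgroup.closure_induction with
    | mem z hz =>
      obtain ⟨z, hz, rfl⟩ := hz
      simp only [Set.mem_compl_iff, Set.mem_insert_iff, Set.mem_singleton_iff, not_or] at hz
      exact h0 z hz.1 hz.2
    | one => exact hD.map_one
    | mul z w _ _ hz hw => exact fun q => by rw [hD, hz, hw, add_zero]
    | inv z _ hz => exact fun q => by rw [hD.map_inv, hz, neg_zero]
  rcases hv with rfl | rfl
  -- The indicator of one `y`-edge: `γ` crosses it forwards when started at `1` and backwards when
  -- started at `π v`. The second case uses an `x`-edge in the same way.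
  · obtain ⟨D, hD, hDm⟩ := exists_isCocycle π (fun z q =>
      if z = y ∧ q = π ((of x)⁻¹ * (of y)⁻¹ * δ) then 1 else 0)
    refine ⟨D, hD, fun q => ?_⟩
    rw [hD, hcocδ hD (fun z _ hz q => by rw [hDm, if_neg (by tauto)]), hD, hD, hD, hD.map_inv,
      hD.map_inv]
    simp only [hDm, hxy, false_and, if_false, true_and]
    have h1 : π (of x)⁻¹ * (π (of y)⁻¹ * (π δ * q)) = π ((of x)⁻¹ * (of y)⁻¹ * δ) ↔ q = 1 := by
      simp [mul_assoc]
    have h2 : π (of y)⁻¹ * (π δ * q) = π ((of x)⁻¹ * (of y)⁻¹ * δ) ↔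
        q = π (δ⁻¹ * of y * (of x)⁻¹ * (of y)⁻¹ * δ) := by
      rw [← mul_assoc, ← eq_inv_mul_iff_mul_eq]
      simp [mul_assoc]
    simp only [h1, h2]
    ring
  · obtain ⟨D, hD, hDm⟩ := exists_isCocycle π (fun z q =>
      if z = x ∧ q = π (of y * (of x)⁻¹ * (of y)⁻¹ * δ) then 1 else 0)
    refine ⟨D, hD, fun q => ?_⟩
    rw [hD, hcocδ hD (fun z hz _ q => by rw [hDm, if_neg (by tauto)]), hD, hD, hD, hD.map_inv,
      hD.map_inv]
    simp only [hDm, hxy.symm, false_and, if_false, true_and]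
    have h1 : π (of y) * (π (of x)⁻¹ * (π (of y)⁻¹ * (π δ * q))) =
        π (of y * (of x)⁻¹ * (of y)⁻¹ * δ) ↔ q = 1 := by
      simp [mul_assoc]
    have h2 : π (of x)⁻¹ * (π (of y)⁻¹ * (π δ * q)) = π (of y * (of x)⁻¹ * (of y)⁻¹ * δ) ↔
        q = π (δ⁻¹ * of y * of x * of y * (of x)⁻¹ * (of y)⁻¹ * δ) := by
      rw [← mul_assoc, ← mul_assoc, ← eq_inv_mul_iff_mul_eq]
      simp [mul_assoc]
    simp only [h1, h2]
    ring

/-- The homomorphism to a cyclic group that counts the occurrences of one generator. -/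
noncomputable def exponentHom (X : Type*) (A : Type*) [AddCommGroupWithOne A] (x : X) :
    FreeGroup X →* Multiplicative A :=
  open Classical in lift fun z => if z = x then Multiplicative.ofAdd 1 else 1

theorem exponentHom_of_self {A : Type*} [AddCommGroupWithOne A] (x : X) :
    exponentHom X A x (of x) = Multiplicative.ofAdd 1 := by
  simp [exponentHom]

theorem exponentHom_of_ne {A : Type*} [AddCommGroupWithOne A] {x z : X} (h : z ≠ x) :
    exponentHom X A x (of z) = 1 := by
  simp [exponentHom, h]

theorem exponentHom_eq_one {A : Type*} [AddCommGroupWithOne A] {x : X} {s : Set X} (hx : x ∈ s)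
    {δ : FreeGroup X} (hδ : δ ∈ Subgroup.closure (of '' sᶜ)) : exponentHom X A x δ = 1 := by
  refine (Subgroup.closure_le (exponentHom X A x).ker).2 ?_ hδ
  rintro _ ⟨z, hz, rfl⟩
  exact exponentHom_of_ne fun h => hz (h ▸ hx)

/-- Elements `[x, y] * δ`, where `x` and `y` do not occur in `δ`, are boundary elements. -/
theorem isBoundaryElement {p : ℕ} (hp : p.Prime) {x y : X} (hxy : x ≠ y) {δ : FreeGroup X}
    (hδ : δ ∈ Subgroup.closure (of '' {x, y}ᶜ)) :
    IsBoundaryElement p (of x * of y * (of x)⁻¹ * (of y)⁻¹ * δ) := by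
  classical
  set γ := of x * of y * (of x)⁻¹ * (of y)⁻¹ * δ with hγ
  set v₁ := δ⁻¹ * of y * (of x)⁻¹ * (of y)⁻¹ * δ with hv₁
  set v₂ := δ⁻¹ * of y * of x * of y * (of x)⁻¹ * (of y)⁻¹ * δ with hv₂
  have hδx : ∀ (A : Type) [AddCommGroupWithOne A], exponentHom X A x δ = 1 :=
    fun A _ => exponentHom_eq_one (by simp) hδ
  have hδy : ∀ (A : Type) [AddCommGroupWithOne A], exponentHom X A y δ = 1 :=
    fun A _ => exponentHom_eq_one (by simp) hδ
  have hγx : ∀ (A : Type) [AddCommGroupWithOne A], exponentHom X A x γ = 1 := fun A _ => by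
    simp [hγ, hδx, exponentHom_of_ne hxy.symm]
  have hγy : ∀ (A : Type) [AddCommGroupWithOne A], exponentHom X A y γ = 1 := fun A _ => by
    simp [hγ, hδy, exponentHom_of_ne hxy]
  have hv₁x : ∀ (A : Type) [AddCommGroupWithOne A],
      exponentHom X A x v₁ = (Multiplicative.ofAdd 1)⁻¹ := fun A _ => by
    simp [hv₁, hδx, exponentHom_of_ne hxy.symm, exponentHom_of_self]
  have hv₂x : exponentHom X ℤ x v₂ = 1 := by
    simp [hv₂, hδx, exponentHom_of_ne hxy.symm]
  have hv₂y : exponentHom X ℤ y v₂ = Multiplicative.ofAdd 1 := by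
    simp [hv₂, hδy, exponentHom_of_ne hxy, exponentHom_of_self]
  have hone : (Multiplicative.ofAdd (1 : ℤ)) ≠ 1 := by decide
  have hnotx : ∀ v, exponentHom X ℤ x v ≠ 1 → v ∉ Subgroup.zpowers γ := by
    rintro v hv ⟨a, rfl⟩
    exact hv (by simp [hγx])
  have hnoty : ∀ v, exponentHom X ℤ y v ≠ 1 → v ∉ Subgroup.zpowers γ := by
    rintro v hv ⟨a, rfl⟩
    exact hv (by simp [hγy])
  refine ⟨fun w hw => exists_isPNormal_notMem hp hw, fun r => ?_, fun h hc => ?_, fun h hh => ?_⟩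
  -- Modulo `p`, the exponent of `x` kills `γ` but not `v₁`, so `D γ 1 = 1` and the cocycle reads
  -- off the exponent of a power of `γ`.
  · have : Fact p.Prime := ⟨hp⟩
    let π := exponentHom X (ZMod p) x
    obtain ⟨D, hD, hDγ⟩ := exists_isCocycle_commutator π hxy hδ (v := v₁) (Or.inl hv₁)
    have hker : IsPNormal p π.ker := by
      refine ⟨inferInstance, ?_⟩
      have h1 : π.ker.index ∣ p ^ 1 := by
        rw [Subgroup.index_ker, pow_one]
        have := Subgroup.card_subgroup_dvd_card π.range
        rwa [show Nat.card (Multiplicative (ZMod p)) = p from Nat.card_zmod p] at this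
      obtain ⟨k, -, hk⟩ := (Nat.dvd_prime_pow hp).1 h1
      exact ⟨k, hk⟩
    have hfin : Finite (Multiplicative (ZMod p)) := inferInstanceAs (Finite (ZMod p))
    have hγk : γ ∈ π.ker := hγx (ZMod p)
    refine ⟨hD.kerMod (p ^ r), hD.isPNormal_kerMod hp hker r, fun a => ?_⟩
    rw [hD.mem_kerMod]
    constructor
    · intro h
      have h1 := h.2 1
      rw [hD.map_zpow_of_mem hγk, hDγ, if_pos rfl, if_neg, sub_zero, mul_one] at h1
      · exact h1
      · rw [hv₁x, eq_comm, inv_eq_one, ofAdd_eq_one]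
        exact one_ne_zero
    · refine fun h => ⟨zpow_mem hγk a, fun q => ?_⟩
      rw [hD.map_zpow_of_mem hγk]
      exact dvd_mul_of_dvd_left h _
  -- If `γ = z ^ b`, then `1 = D γ 1 = b * D z 1`, so `b = ±1`: `γ` is not a proper power.
  · obtain ⟨z, a, b, rfl, hb⟩ := exists_zpow_eq_of_commute hc
    obtain ⟨D, hD, hDγ⟩ := exists_isCocycle_commutator (exponentHom X ℤ x) hxy hδ
      (v := v₁) (Or.inl hv₁)
    have hDγ1 : D γ 1 = 1 := by
      rw [hDγ, if_pos rfl, if_neg, sub_zero]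
      rw [hv₁x, eq_comm, inv_eq_one]
      exact hone
    have hb0 : b ≠ 0 := by
      rintro rfl
      rw [← hb, zpow_zero, hD.map_one] at hDγ1
      exact zero_ne_one hDγ1
    have hz : z ∈ (exponentHom X ℤ x).ker := by
      have h1 := hγx ℤ
      rw [← hb, map_zpow, ← toAdd_eq_zero, toAdd_zpow, smul_eq_zero] at h1
      exact toAdd_eq_zero.1 (h1.resolve_left hb0)
    rw [← hb, hD.map_zpow_of_mem hz] at hDγ1
    have hbb : b * b = 1 := by
      rcases Int.isUnit_iff.1 (IsUnit.of_mul_eq_one _ hDγ1) with rfl | rfl <;> rfl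
    refine ⟨b * a, ?_⟩
    simp only
    rw [← hb, ← zpow_mul, ← mul_assoc, hbb, one_mul]
  -- At least one of `v₁`, `v₂` works: if `v₁ * h` and `v₂ * h` were both powers of `γ`, so would be
  -- `v₁ * v₂⁻¹`, whose exponent in `x` is `-1`.
  · by_cases h1 : v₁ * h ∈ Subgroup.zpowers γ
    · refine ⟨v₂, hnoty _ (by rwa [hv₂y]), fun h2 => ?_, fun N hN => by
        convert exists_isCocycle_commutator (QuotientGroup.mk' N) hxy hδ (v := v₂) (Or.inr hv₂)
        rfl⟩
      have h3 := mul_mem h1 (inv_mem h2)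
      refine hnotx (v₁ * v₂⁻¹) ?_ ?_
      · simp only [_root_.map_mul, _root_.map_inv, hv₁x, hv₂x]
        simp
      · convert h3 using 1
        group
    · exact ⟨v₁, hnotx _ (by rw [hv₁x]; simp), h1, fun N hN => by
        convert exists_isCocycle_commutator (QuotientGroup.mk' N) hxy hδ (v := v₁) (Or.inl hv₁)
        rfl⟩

end FreeGroup

theorem isBoundaryElement_commutatorProduct {p : ℕ} (hp : p.Prime) {n : ℕ} (hn : 1 ≤ n) :
    IsBoundaryElement p (commutatorProduct n) := by
  obtain ⟨n, rfl⟩ := Nat.exists_eq_add_of_le' hn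
  rw [commutatorProduct, List.ofFn_succ, List.prod_cons]
  refine FreeGroup.isBoundaryElement hp (by simp) (Subgroup.list_prod_mem _ ?_)
  intro z hz
  obtain ⟨i, rfl⟩ := List.mem_ofFn.1 hz
  have h1 : FreeGroup.of (Sum.inl i.succ) ∈ Subgroup.closure
      (FreeGroup.of '' ({Sum.inl 0, Sum.inr 0}ᶜ : Set (Fin (n + 1) ⊕ Fin (n + 1)))) :=
    Subgroup.subset_closure ⟨_, by simp, rfl⟩
  have h2 : FreeGroup.of (Sum.inr i.succ) ∈ Subgroup.closure
      (FreeGroup.of '' ({Sum.inl 0, Sum.inr 0}ᶜ : Set (Fin (n + 1) ⊕ Fin (n + 1)))) :=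
    Subgroup.subset_closure ⟨_, by simp, rfl⟩
  exact mul_mem (mul_mem (mul_mem h1 h2) (inv_mem h1)) (inv_mem h2)

/-! ### Maps of amalgams and lifting of links -/

namespace Amalgam

open Monoid

section Map

variable {ι : Type*} {G P : ι → Type*} [∀ i, Group (G i)] [∀ i, Group (P i)] {C C' : Type*}
  [Group C] [Group C'] {κ : ∀ i, C' →* P i} {φ : ∀ i, C →* G i}

/-- The homomorphism of amalgams induced by compatible homomorphisms of the factors. -/
def map (θ : ∀ i, G i →* P i) (ψ : C →* C') (h : ∀ i, (θ i).comp (φ i) = (κ i).comp ψ) :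
    PushoutI φ →* PushoutI κ :=
  PushoutI.lift (fun i => (PushoutI.of i).comp (θ i)) ((PushoutI.base κ).comp ψ) fun i => by
    rw [MonoidHom.comp_assoc, h, ← MonoidHom.comp_assoc, PushoutI.of_comp_eq_base]

/-- Apply homomorphisms of the factors to the letters of a list. -/
def mapList (θ : ∀ i, G i →* P i) (L : List (Σ i, G i)) : List (Σ i, P i) :=
  L.map fun x => ⟨x.1, θ x.1 x.2⟩

variable (θ : ∀ i, G i →* P i)

@[simp] theorem mapList_cons (i : ι) (x : G i) (L : List (Σ i, G i)) :
    mapList θ (⟨i, x⟩ :: L) = ⟨i, θ i x⟩ :: mapList θ L := rfl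

@[simp] theorem map_fst_mapList (L : List (Σ i, G i)) :
    (mapList θ L).map Sigma.fst = L.map Sigma.fst := by
  simp [mapList, Function.comp_def]

variable {θ} {ψ : C →* C'} (h : ∀ i, (θ i).comp (φ i) = (κ i).comp ψ)

@[simp] theorem map_of (i : ι) (x : G i) :
    map θ ψ h (PushoutI.of i x) = PushoutI.of i (θ i x) := by
  simp [map]

theorem map_listProd (L : List (Σ i, G i)) :
    map θ ψ h (listProd φ L) = listProd κ (mapList θ L) := by
  induction L with
  | nil => simp [mapList]
  | cons x L ih =>
    obtain ⟨i, x⟩ := x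
    simp [ih]

theorem IsCyclicList.mapList {L : List (Σ i, G i)} (hL : IsCyclicList φ L)
    (h : ∀ x ∈ L, θ x.1 x.2 ∉ (κ x.1).range) : IsCyclicList κ (mapList θ L) := by
  refine ⟨by simpa [Amalgam.mapList] using hL.1, by simpa only [map_fst_mapList] using hL.2.1, ?_⟩
  intro x hx
  obtain ⟨y, hy, rfl⟩ := List.mem_map.1 hx
  exact h y hy

theorem exists_isRotated_of_mapList {L : List (Σ i, G i)} {M : List (Σ i, P i)}
    (h : M ~r mapList θ L) : ∃ M', M' ~r L ∧ M = mapList θ M' := by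
  obtain ⟨n, rfl⟩ := h.symm
  exact ⟨L.rotate n, (List.IsRotated.forall L n), (List.map_rotate _ _ _).symm⟩

end Map

section Lift

variable {ι : Type*} {G P : ι → Type*} [∀ i, Group (G i)] [∀ i, Group (P i)] {C' : Type*}
  [Group C'] {φ : ∀ i, Multiplicative ℤ →* G i} {κ : ∀ i, C' →* P i} {θ : ∀ i, G i →* P i}
  {ψ : Multiplicative ℤ →* C'}

theorem eq_of_dvd_sub_of_abs_le {q B a b : ℤ} (hB : 2 * B < q) (ha : |a| ≤ B) (hb : |b| ≤ B)
    (h : q ∣ a - b) : a = b := by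
  have h1 : |a - b| < q := by
    have := abs_sub a b
    linarith
  exact sub_eq_zero.1 (Int.eq_zero_of_abs_lt_dvd h h1)

/-- Links between lists in a quotient amalgam lift, if solutions in the factors do. -/
theorem exists_linked_of_linked_mapList (hψ : Function.Surjective ψ) {q B : ℤ} (hB : 2 * B < q)
    {W M : List (Σ i, G i)} (hW : W ≠ [])
    (hsep : ∀ i x y, ⟨i, x⟩ ∈ W → ⟨i, y⟩ ∈ M → ∀ a b : ℤ,
      κ i (ψ (.ofAdd a)) * θ i x = θ i y * κ i (ψ (.ofAdd b)) →
      ∃ a₀ b₀ : ℤ, |a₀| ≤ B ∧ |b₀| ≤ B ∧ φ i (.ofAdd a₀) * x = y * φ i (.ofAdd b₀) ∧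
        q ∣ a - a₀ ∧ q ∣ b - b₀) {a b : ℤ}
    (h : Linked κ (ψ (.ofAdd a)) (mapList θ W) (mapList θ M) (ψ (.ofAdd b)))
    (hb : ∀ b' : ℤ, ψ (.ofAdd b') = ψ (.ofAdd b) → q ∣ b' - b) :
    ∃ a₀ b₀ : ℤ, |a₀| ≤ B ∧ |b₀| ≤ B ∧ q ∣ a - a₀ ∧ q ∣ b - b₀ ∧
      Linked φ (.ofAdd a₀) W M (.ofAdd b₀) := by
  induction W generalizing M a with
  | nil => exact absurd rfl hW
  | cons x W ih =>
    obtain ⟨i, x⟩ := x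
    rcases M with _ | ⟨⟨j, y⟩, M⟩
    · cases h
    rw [mapList_cons, mapList_cons] at h
    obtain _ | @⟨_, c₁, _, _, _, _, _, _, hxy, h⟩ := h
    obtain ⟨c, rfl⟩ := hψ c₁
    obtain ⟨c, rfl⟩ := Multiplicative.ofAdd.surjective c
    obtain ⟨a₀, b₀, ha₀, hb₀, heq, hda, hdb⟩ := hsep i x y List.mem_cons_self List.mem_cons_self
      a c hxy
    rcases W with _ | ⟨z, W⟩
    · rcases M with _ | ⟨w, M⟩
      · have hcb : ψ (.ofAdd c) = ψ (.ofAdd b) := by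
          generalize ψ (.ofAdd c) = c₁ at h
          generalize ψ (.ofAdd b) = c₂ at h
          cases h
          rfl
        refine ⟨a₀, b₀, ha₀, hb₀, hda, ?_, .cons heq (.nil _)⟩
        have := dvd_sub hdb (hb c hcb)
        rwa [sub_sub_sub_cancel_left] at this
      · cases h
    · obtain ⟨a₁, b₁, ha₁, hb₁, hda₁, hdb₁, hl⟩ := ih (M := M) (a := c) (by simp)
        (fun i x y hx hy => hsep i x y (List.mem_cons_of_mem _ hx) (List.mem_cons_of_mem _ hy)) h
      -- Both are congruent to `c` modulo `q`, and both are bounded by `B`.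
      obtain rfl : b₀ = a₁ := eq_of_dvd_sub_of_abs_le hB hb₀ ha₁ (by
        have := dvd_sub hda₁ hdb
        rwa [sub_sub_sub_cancel_left] at this)
      exact ⟨a₀, b₁, ha₀, hb₁, hda, hdb₁, .cons heq hl⟩

end Lift

end Amalgam

/-! ### Simultaneous choice of the quotients of the factors -/

namespace IsPNormal

theorem exists_forall {p : ℕ} (hp : p.Prime) {F : Type*} [Group F] {β : Type*} {T : Set β}
    (hT : T.Finite) {S : β → Subgroup F → Prop}
    (hmono : ∀ t {N N' : Subgroup F}, N' ≤ N → S t N → S t N')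
    (h : ∀ t ∈ T, ∃ N : Subgroup F, IsPNormal p N ∧ S t N) :
    ∃ N : Subgroup F, IsPNormal p N ∧ ∀ t ∈ T, S t N := by
  induction T, hT using Set.Finite.induction_on with
  | empty => exact ⟨⊤, top, by simp⟩
  | @insert a T _ _ ih =>
    obtain ⟨N, hN, hS⟩ := ih fun t ht => h t (Set.mem_insert_of_mem _ ht)
    obtain ⟨N', hN', hS'⟩ := h a (Set.mem_insert _ _)
    refine ⟨N ⊓ N', hN.inf hp hN', ?_⟩
    rintro t (rfl | ht)
    exacts [hmono _ inf_le_right hS', hmono _ inf_le_left (hS t ht)]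

end IsPNormal

theorem Amalgam.finite_pairs {ι : Type*} {G : ι → Type*} (W L : List (Σ i, G i)) :
    {t : Σ i, G i × G i | ⟨t.1, t.2.1⟩ ∈ W ∧ ⟨t.1, t.2.2⟩ ∈ L}.Finite := by
  have hf : Function.Injective fun t : Σ i, G i × G i =>
      ((⟨t.1, t.2.1⟩, ⟨t.1, t.2.2⟩) : (Σ i, G i) × (Σ i, G i)) := by
    rintro ⟨i, x, y⟩ ⟨j, x', y'⟩ h
    simp only [Prod.mk.injEq, Sigma.mk.injEq] at h
    obtain ⟨⟨rfl, h1⟩, -, h2⟩ := h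
    simp_all
  exact (W.finite_toSet.prod L.finite_toSet).preimage hf.injOn

namespace IsBoundaryElement

variable {p : ℕ} {ι : Type*} {G : ι → Type*} [∀ i, Group (G i)] {γ : ∀ i, G i}

/-- Small normal subgroups of `p`-power index modulo which the boundary elements all have the same
order. -/
theorem exists_family [Finite ι] (hp : p.Prime) (hγ : ∀ i, IsBoundaryElement p (γ i))
    {S : ∀ i, Subgroup (G i) → Prop}
    (hmono : ∀ i {N N' : Subgroup (G i)}, N' ≤ N → S i N → S i N')
    (h : ∀ i, ∃ N : Subgroup (G i), IsPNormal p N ∧ S i N) (K : ℕ) :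
    ∃ (r : ℕ) (N : ∀ i, Subgroup (G i)), K ≤ r ∧ (∀ i, IsPNormal p (N i)) ∧ (∀ i, S i (N i)) ∧
      ∀ i (a : ℤ), γ i ^ a ∈ N i ↔ ((p ^ r : ℕ) : ℤ) ∣ a := by
  choose N hN hS using h
  choose s hs using fun i => (hN i).exists_zpow_mem_iff hp (γ i)
  obtain ⟨r, hr⟩ := (Set.finite_range s).bddAbove
  choose M hM hMr using fun i => (hγ i).exists_zpow_mem_iff (max r K)
  refine ⟨max r K, fun i => N i ⊓ M i, le_max_right _ _, fun i => (hN i).inf hp (hM i),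
    fun i => hmono i inf_le_left (hS i), fun i a => ?_⟩
  rw [Subgroup.mem_inf, hs, hMr, and_iff_right_iff_imp]
  refine (Int.natCast_dvd_natCast.2 (pow_dvd_pow p ?_)).trans
  exact (hr ⟨i, rfl⟩).trans (le_max_left _ _)

/-- In `exists_zpow_eq` the exponents `a₀`, `b₀` do not depend on `K`. Hence `B` can bound them over
the finitely many pairs of letters before the modulus `q = p ^ K > 2 * B` and the subgroups are
chosen. -/
theorem exists_family_separating [Finite ι] (hp : p.Prime) (hγ : ∀ i, IsBoundaryElement p (γ i))
    {W L : List (Σ i, G i)} (hW : ∀ u ∈ W, u.2 ∉ Subgroup.zpowers (γ u.1))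
    (hL : ∀ u ∈ L, u.2 ∉ Subgroup.zpowers (γ u.1)) :
    ∃ (r : ℕ) (N : ∀ i, Subgroup (G i)) (B q : ℤ), (∀ i, IsPNormal p (N i)) ∧
      (∀ i (a : ℤ), γ i ^ a ∈ N i ↔ ((p ^ r : ℕ) : ℤ) ∣ a) ∧
      (∀ u, u ∈ W ∨ u ∈ L → ∀ a : ℤ, γ u.1 ^ a * u.2 ∉ N u.1) ∧
      2 * B < q ∧ q ∣ ((p ^ r : ℕ) : ℤ) ∧
      ∀ i x y, ⟨i, x⟩ ∈ W → ⟨i, y⟩ ∈ L → ∀ a b : ℤ, γ i ^ a * x * γ i ^ (-b) * y⁻¹ ∈ N i →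
        ∃ a₀ b₀ : ℤ, |a₀| ≤ B ∧ |b₀| ≤ B ∧ γ i ^ a₀ * x = y * γ i ^ b₀ ∧
          q ∣ a - a₀ ∧ q ∣ b - b₀ := by
  have hsol : ∀ i (x y : G i), ∃ a₀ b₀ : ℤ, x ∉ Subgroup.zpowers (γ i) →
      ∀ K : ℕ, ∃ N : Subgroup (G i), IsPNormal p N ∧
      ∀ a b : ℤ, γ i ^ a * x * γ i ^ (-b) * y⁻¹ ∈ N →
        γ i ^ a₀ * x = y * γ i ^ b₀ ∧ ((p ^ K : ℕ) : ℤ) ∣ a - a₀ ∧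
          ((p ^ K : ℕ) : ℤ) ∣ b - b₀ := by
    intro i x y
    by_cases hx : x ∈ Subgroup.zpowers (γ i)
    · exact ⟨0, 0, fun h => absurd hx h⟩
    · obtain ⟨a₀, b₀, h⟩ := (hγ i).exists_zpow_eq hp hx y
      exact ⟨a₀, b₀, fun _ => h⟩
  choose a₀ b₀ hsol using hsol
  obtain ⟨B, hB⟩ := ((Amalgam.finite_pairs W L).image
    fun t : Σ i, G i × G i => |a₀ t.1 t.2.1 t.2.2| + |b₀ t.1 t.2.1 t.2.2|).bddAbove
  have hB' : ∀ i x y, ⟨i, x⟩ ∈ W → ⟨i, y⟩ ∈ L → |a₀ i x y| + |b₀ i x y| ≤ B :=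
    fun i x y hx hy => hB ⟨⟨i, x, y⟩, ⟨hx, hy⟩, rfl⟩
  obtain ⟨K, hK⟩ : ∃ K : ℕ, 2 * B < ((p ^ K : ℕ) : ℤ) := by
    obtain ⟨K, hK⟩ := pow_unbounded_of_one_lt (2 * B) (by exact_mod_cast hp.one_lt : (1 : ℤ) < p)
    exact ⟨K, by exact_mod_cast hK⟩
  have hfamily : ∀ i, ∃ N : Subgroup (G i), IsPNormal p N ∧
      ((∀ t ∈ {t : G i × G i | ⟨i, t.1⟩ ∈ W ∧ ⟨i, t.2⟩ ∈ L}, ∀ a b : ℤ,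
        γ i ^ a * t.1 * γ i ^ (-b) * t.2⁻¹ ∈ N →
        γ i ^ a₀ i t.1 t.2 * t.1 = t.2 * γ i ^ b₀ i t.1 t.2 ∧
          ((p ^ K : ℕ) : ℤ) ∣ a - a₀ i t.1 t.2 ∧ ((p ^ K : ℕ) : ℤ) ∣ b - b₀ i t.1 t.2) ∧
      ∀ x ∈ {x : G i | ⟨i, x⟩ ∈ W ++ L}, ∀ a : ℤ, γ i ^ a * x ∉ N) := by
    intro i
    have hfin₁ : {t : G i × G i | ⟨i, t.1⟩ ∈ W ∧ ⟨i, t.2⟩ ∈ L}.Finite :=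
      (Amalgam.finite_pairs W L).preimage
        (f := fun t : G i × G i => (⟨i, t⟩ : Σ i, G i × G i)) fun _ _ _ _ h => by simpa using h
    have hfin₂ : {x : G i | ⟨i, x⟩ ∈ W ++ L}.Finite :=
      (W ++ L).finite_toSet.preimage (f := (Sigma.mk i : G i → Σ i, G i)) sigma_mk_injective.injOn
    obtain ⟨N₁, hN₁, h₁⟩ := IsPNormal.exists_forall hp hfin₁
      (S := fun t N => ∀ a b : ℤ, γ i ^ a * t.1 * γ i ^ (-b) * t.2⁻¹ ∈ N →
        γ i ^ a₀ i t.1 t.2 * t.1 = t.2 * γ i ^ b₀ i t.1 t.2 ∧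
          ((p ^ K : ℕ) : ℤ) ∣ a - a₀ i t.1 t.2 ∧ ((p ^ K : ℕ) : ℤ) ∣ b - b₀ i t.1 t.2)
      (fun t N N' hle h a b hab => h a b (hle hab))
      (fun t ht => hsol i t.1 t.2 (hW _ ht.1) K)
    obtain ⟨N₂, hN₂, h₂⟩ := IsPNormal.exists_forall hp hfin₂
      (S := fun x N => ∀ a : ℤ, γ i ^ a * x ∉ N)
      (fun t N N' hle h a ha => h a (hle ha))
      (fun x hx => (hγ i).exists_forall_zpow_mul_notMem (by
        rcases List.mem_append.1 hx with hx | hx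
        exacts [hW _ hx, hL _ hx]))
    exact ⟨N₁ ⊓ N₂, hN₁.inf hp hN₂, fun t ht a b hab => h₁ t ht a b hab.1,
      fun x hx a ha => h₂ x hx a ha.2⟩
  obtain ⟨r, N, hr, hN, hS, hord⟩ := exists_family hp hγ
    (S := fun i N => (∀ t ∈ {t : G i × G i | ⟨i, t.1⟩ ∈ W ∧ ⟨i, t.2⟩ ∈ L}, ∀ a b : ℤ,
        γ i ^ a * t.1 * γ i ^ (-b) * t.2⁻¹ ∈ N →
        γ i ^ a₀ i t.1 t.2 * t.1 = t.2 * γ i ^ b₀ i t.1 t.2 ∧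
          ((p ^ K : ℕ) : ℤ) ∣ a - a₀ i t.1 t.2 ∧ ((p ^ K : ℕ) : ℤ) ∣ b - b₀ i t.1 t.2) ∧
      ∀ x ∈ {x : G i | ⟨i, x⟩ ∈ W ++ L}, ∀ a : ℤ, γ i ^ a * x ∉ N)
    (fun i N N' hle h => ⟨fun t ht a b hab => h.1 t ht a b (hle hab),
      fun x hx a ha => h.2 x hx a (hle ha)⟩) hfamily K
  refine ⟨r, N, B, ((p ^ K : ℕ) : ℤ), hN, hord, ?_, hK,
    Int.natCast_dvd_natCast.2 (pow_dvd_pow p hr), ?_⟩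
  · rintro ⟨i, x⟩ hu a
    exact (hS i).2 x (List.mem_append.2 hu) a
  · intro i x y hx hy a b hab
    have hle := hB' i x y hx hy
    have h1 := abs_nonneg (a₀ i x y)
    have h2 := abs_nonneg (b₀ i x y)
    exact ⟨a₀ i x y, b₀ i x y, by linarith, by linarith, (hS i).1 (x, y) ⟨hx, hy⟩ a b hab⟩

end IsBoundaryElement

/-! ### Separation of conjugacy classes -/

namespace Amalgam

open Monoid

/-- Conjugacy classes of cyclic lists in an amalgam along boundary elements are separated by
amalgams of finite `p`-groups. -/
theorem exists_pGroup_amalgam {p : ℕ} (hp : p.Prime) {ι : Type*} [Finite ι] [Nonempty ι]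
    {G : ι → Type} [∀ i, Group (G i)] {γ : ∀ i, G i} (hγ : ∀ i, IsBoundaryElement p (γ i))
    {φ : ∀ i, Multiplicative ℤ →* G i} (hφ : ∀ i (a : ℤ), φ i (.ofAdd a) = γ i ^ a)
    {L : List (Σ i, G i)} (hL : IsCyclicList φ L) {h : PushoutI φ}
    (hh : ¬ IsConj h (listProd φ L)) :
    ∃ (P : ι → Type) (_ : ∀ i, Group (P i)) (C : Type) (_ : Group C) (κ : ∀ i, C →* P i)
      (Φ : PushoutI φ →* PushoutI κ) (L' : List (Σ i, P i)),
      (∀ i, Finite (P i)) ∧ (∀ i, IsPGroup p (P i)) ∧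
      IsCyclic C ∧ (∀ i, Function.Injective (κ i)) ∧
      IsCyclicList κ L' ∧ L'.map Sigma.fst = L.map Sigma.fst ∧
      Φ (listProd φ L) = listProd κ L' ∧ ¬ IsConj (Φ h) (Φ (listProd φ L)) := by
  have hrange : ∀ i (x : G i), x ∉ (φ i).range → x ∉ Subgroup.zpowers (γ i) := by
    rintro i x hx ⟨a, rfl⟩
    exact hx ⟨.ofAdd a, hφ i a⟩
  have hinj : ∀ i, Function.Injective (φ i) := by
    intro i
    rw [injective_iff_map_eq_one]
    intro a ha
    obtain ⟨a, rfl⟩ := Multiplicative.ofAdd.surjective a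
    rw [hφ] at ha
    obtain ⟨r, hr⟩ := pow_unbounded_of_one_lt |a| (by exact_mod_cast hp.one_lt : (1 : ℤ) < p)
    obtain ⟨N, -, hN⟩ := (hγ i).exists_zpow_mem_iff r
    rw [Int.eq_zero_of_abs_lt_dvd ((hN a).1 (ha ▸ one_mem N)) (by exact_mod_cast hr)]
    rfl
  obtain ⟨W, hW, hcase⟩ : ∃ W : List (Σ i, G i), (∀ u ∈ W, u.2 ∉ Subgroup.zpowers (γ u.1)) ∧
      ((∃ i x, IsConj (PushoutI.of i x) h) ∨ IsCyclicList φ W ∧ IsConj (listProd φ W) h) := by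
    rcases exists_isConj hinj h with hc | ⟨W, hW, hc⟩
    -- When `h` is conjugate into a factor there are no letters of `h` to separate.
    · exact ⟨[], by simp, Or.inl hc⟩
    · exact ⟨W, fun u hu => hrange _ _ (hW.2.2 u hu), Or.inr ⟨hW, hc⟩⟩
  obtain ⟨r, N, B, q, hN, hord, hnot, hB, hq, hsep⟩ :=
    IsBoundaryElement.exists_family_separating hp hγ hW fun u hu => hrange _ _ (hL.2.2 u hu)
  have hn : ∀ i, (N i).Normal := fun i => (hN i).1
  obtain ⟨i₀⟩ := ‹Nonempty ι›
  -- All `γ i` have the same order modulo `N i`, so the choice of `i₀` is immaterial and `C ⧸ S`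
  -- embeds in every quotient.
  let S : Subgroup (Multiplicative ℤ) := (N i₀).comap (φ i₀)
  have hmemS : ∀ a : ℤ, Multiplicative.ofAdd a ∈ S ↔ ((p ^ r : ℕ) : ℤ) ∣ a := fun a => by
    rw [Subgroup.mem_comap, hφ, hord]
  have hS : ∀ i, S = (N i).comap (φ i) := by
    intro i
    ext a
    obtain ⟨a, rfl⟩ := Multiplicative.ofAdd.surjective a
    rw [hmemS, Subgroup.mem_comap, hφ, hord]
  let κ : ∀ i, Multiplicative ℤ ⧸ S →* G i ⧸ N i := fun i =>
    QuotientGroup.map S (N i) (φ i) (hS i).le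
  have hκ : ∀ i (a : ℤ), κ i (QuotientGroup.mk' S (.ofAdd a)) = ((γ i ^ a : G i) : G i ⧸ N i) :=
    fun i a => by rw [← hφ]; rfl
  have hκinj : ∀ i, Function.Injective (κ i) := by
    intro i
    rw [injective_iff_map_eq_one]
    intro a ha
    obtain ⟨a, rfl⟩ := QuotientGroup.mk'_surjective S a
    obtain ⟨a, rfl⟩ := Multiplicative.ofAdd.surjective a
    rw [hκ, QuotientGroup.eq_one_iff, hord, ← hmemS] at ha
    exact (QuotientGroup.eq_one_iff _).2 ha
  have hcomm : ∀ i, (QuotientGroup.mk' (N i)).comp (φ i) = (κ i).comp (QuotientGroup.mk' S) :=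
    fun i => rfl
  have hlet : ∀ u, u ∈ W ∨ u ∈ L → QuotientGroup.mk' (N u.1) u.2 ∉ (κ u.1).range := by
    rintro ⟨i, x⟩ hu ⟨c, hc⟩
    obtain ⟨a, rfl⟩ := QuotientGroup.mk'_surjective S c
    obtain ⟨a, rfl⟩ := Multiplicative.ofAdd.surjective a
    rw [hκ, QuotientGroup.mk'_apply, QuotientGroup.eq, ← zpow_neg] at hc
    exact hnot _ hu (-a) hc
  let θ : ∀ i, G i →* G i ⧸ N i := fun i => QuotientGroup.mk' (N i)
  have hL' : IsCyclicList κ (mapList θ L) := hL.mapList fun u hu => hlet u (Or.inr hu)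
  refine ⟨fun i => G i ⧸ N i, inferInstance, Multiplicative ℤ ⧸ S, inferInstance, κ,
    map θ (QuotientGroup.mk' S) hcomm, mapList θ L, fun i => (hN i).finite hp,
    fun i => (hN i).isPGroup, isCyclic_of_surjective _ (QuotientGroup.mk'_surjective S), hκinj,
    hL', map_fst_mapList θ L, map_listProd hcomm L, fun hconj => ?_⟩
  rcases hcase with ⟨i, x, hx⟩ | ⟨hWc, hWh⟩
  · have h1 := ((map θ (QuotientGroup.mk' S) hcomm).map_isConj hx).trans hconj
    rw [map_of, map_listProd] at h1
    exact not_isConj_of hκinj hL' _ _ h1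
  · have hW' : IsCyclicList κ (mapList θ W) := hWc.mapList fun u hu => hlet u (Or.inl hu)
    have h1 := ((map θ (QuotientGroup.mk' S) hcomm).map_isConj hWh).trans hconj
    rw [map_listProd, map_listProd] at h1
    obtain ⟨M', c, hM', hlink⟩ := exists_linked_of_isConj hκinj hL' hW' h1
    obtain ⟨M, hM, rfl⟩ := exists_isRotated_of_mapList hM'
    obtain ⟨a, rfl⟩ := QuotientGroup.mk'_surjective S c
    obtain ⟨a, rfl⟩ := Multiplicative.ofAdd.surjective a
    obtain ⟨a₀, b₀, ha₀, hb₀, hda, hdb, hl⟩ := exists_linked_of_linked_mapList (φ := φ)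
      (QuotientGroup.mk'_surjective S) hB hWc.1 (fun i x y hx hy a b hab => by
        rw [hκ, hκ] at hab
        simp only [hφ]
        refine hsep i x y hx (hM.mem_iff.1 hy) a b ?_
        rw [← QuotientGroup.eq_one_iff]
        have h2 : ((γ i ^ a * x : G i) : G i ⧸ N i) = ((y * γ i ^ b : G i) : G i ⧸ N i) := hab
        rw [QuotientGroup.mk_mul, QuotientGroup.mk_mul, h2, ← QuotientGroup.mk_mul,
          ← QuotientGroup.mk_mul]
        simp) hlink (fun b' hb' => hq.trans (by
          rw [QuotientGroup.mk'_apply, QuotientGroup.mk'_apply, QuotientGroup.eq, ← ofAdd_neg,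
            ← ofAdd_add, hmemS] at hb'
          rwa [← dvd_neg, neg_sub, sub_eq_neg_add]))
    -- The quotient link begins and ends with the same element, so the lifted ends agree modulo `q`
    -- and hence exactly; the lifted link is a conjugation by an element of `C`.
    obtain rfl : a₀ = b₀ := eq_of_dvd_sub_of_abs_le hB ha₀ hb₀ (by
      have := dvd_sub hdb hda
      rwa [sub_sub_sub_cancel_left] at this)
    have h2 : IsConj (listProd φ W) (listProd φ M) :=
      isConj_iff.2 ⟨PushoutI.base φ (.ofAdd a₀), by rw [hl.base_mul_eq]; group⟩
    exact hh (hWh.symm.trans (h2.trans (isConj_of_isRotated hM)))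

theorem getLast_cons_eq_iff (l : List (Fin 2)) (i : Fin 2) (h : (i :: l).IsChain (· ≠ ·)) :
    (i :: l).getLast (by simp) = i ↔ Even l.length := by
  induction l generalizing i with
  | nil => simp
  | cons j l ih =>
    rw [List.isChain_cons_cons] at h
    rw [List.getLast_cons (by simp), List.length_cons, Nat.even_add_one, ← ih j h.2]
    have := h.1
    generalize (j :: l).getLast _ = k
    omega

/-- With two factors the letters alternate, so a word of even length begins and ends in different
factors. -/
theorem isCyclicList_of_even {H : Fin 2 → Type*} [∀ i, Group (H i)] {C : Type*} [Group C]
    {φ : ∀ i, C →* H i} {L : List (Σ i, H i)} (hL : IsReduced φ L) (hne : L ≠ [])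
    (heven : Even L.length) : IsCyclicList φ L := by
  rcases L with _ | ⟨⟨i, x⟩, L⟩
  · exact absurd rfl hne
  refine isCyclicList_cons.2 ⟨?_, hL.2 _ List.mem_cons_self, hL.of_cons.2⟩
  have h1 : (i :: L.map Sigma.fst).IsChain (· ≠ ·) := hL.1
  rw [← List.cons_append, List.isChain_append]
  refine ⟨h1, by simp, ?_⟩
  rintro k hk l hl rfl
  obtain rfl : i = k := by simpa using hl
  rw [List.getLast?_eq_getLast_of_ne_nil (by simp), Option.mem_some_iff,
    getLast_cons_eq_iff _ _ h1, List.length_map] at hk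
  rw [List.length_cons, Nat.even_add_one] at heven
  exact heven hk

end Amalgam

theorem proposition4p5 (p : ℕ) (hp : p.Prime) (ρ : ℕ) (hρ : 2 ≤ ρ) (x : ClosedSurface ρ)
    (n : Fin 2 → ℕ) (hn : ∀ i, 1 ≤ n i)
    (e : FundamentalGroup (ClosedSurface ρ) x ≃* SurfaceAmalgam n)
    (g h : FundamentalGroup (ClosedSurface ρ) x) (l : ℕ) (hl : 2 ≤ 2 * l)
    (hg : Amalgam.IsCyclicallyReduced (e g)) (hgl : Amalgam.syllableLength (e g) = 2 * l)
    (hgh : ¬ IsConj h g) :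
    ∃ (P : Fin 2 → Type) (_ : ∀ i, Group (P i)) (C : Type) (_ : Group C) (κ : ∀ i, C →* P i)
      (φ : SurfaceAmalgam n →* Monoid.PushoutI κ),
      (∀ i, Finite (P i)) ∧ (∀ i, IsPGroup p (P i)) ∧
      IsCyclic C ∧ (∀ i, Function.Injective (κ i)) ∧
      Amalgam.IsCyclicallyReduced (φ (e g)) ∧
      Amalgam.syllableLength (φ (e g)) = 2 * l ∧
      ¬ IsConj (φ (e h)) (φ (e g)) := by
  have hconj : ¬ IsConj (e h) (e g) := fun hc => hgh (by
    simpa using e.symm.toMonoidHom.map_isConj hc)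
  obtain ⟨w, hw, hlen⟩ : ∃ w, Amalgam.IsNormalForm (e g) w ∧ w.toList.length = 2 * l := by
    -- `sInf ∅ = 0`, so a positive syllable length guarantees a normal form.
    have hne : {k | ∃ w, Amalgam.IsNormalForm (e g) w ∧ w.toList.length = k}.Nonempty := by
      by_contra h0
      rw [Amalgam.syllableLength, Set.not_nonempty_iff_eq_empty.1 h0, Nat.sInf_empty] at hgl
      omega
    obtain ⟨w, hw, hlen⟩ := Nat.sInf_mem hne
    exact ⟨w, hw, hlen.trans hgl⟩
  have hred : Amalgam.IsReduced (surfaceAmalgamMap n) w.toList :=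
    ⟨(List.isChain_map _).2 w.chain_ne, hw.2.1⟩
  have hprod : e g = Amalgam.listProd (surfaceAmalgamMap n) w.toList := by
    rw [← hw.2.2, Amalgam.ofCoprodI_prod_eq_listProd]
  rw [hprod] at hconj ⊢
  obtain ⟨P, _, C, _, κ, Φ, L, hfin, hP, hC, hκ, hL, hLw, hΦ, hnot⟩ :=
    Amalgam.exists_pGroup_amalgam hp (φ := surfaceAmalgamMap n)
      (fun i => isBoundaryElement_commutatorProduct hp (hn i))
      (fun i a => zpowersHom_apply _ _ _)
      (Amalgam.isCyclicList_of_even hred hw.1 (hlen ▸ even_two_mul l)) hconj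
  have hnf : Amalgam.IsNormalForm (Φ (Amalgam.listProd (surfaceAmalgamMap n) w.toList))
      hL.isReduced.word :=
    ⟨hL.1, hL.isReduced.2, by rw [hΦ, Amalgam.ofCoprodI_prod_eq_listProd]; rfl⟩
  have hLlen : hL.isReduced.word.toList.length = 2 * l := by
    rw [← hlen, ← List.length_map (as := w.toList) Sigma.fst, ← hLw, List.length_map]
    rfl
  refine ⟨P, inferInstance, C, inferInstance, κ, Φ, hfin, hP, hC, hκ,
    Or.inr ⟨_, hnf, Or.inr (hLlen ▸ even_two_mul l)⟩, ?_, hnot⟩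
  rw [← hnf.length_eq hκ, hLlen]
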